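/- Let $k$ be a perfect field of characteristic $2$, let $m\ge 2$, let $E$ be a $k$-vector space of dimension $2m+1$, and let $U$ be a $2$-dimensional $k$-vector space. Let $q\colon U\to S^2E^\vee$, $u\mapsto q_u$, be a regular pencil of quadratic forms, i.e. an injective linear map whose base scheme $X=\bigcap_{u\in U}V(q_u)$ in the projective space $|E|\cong\mathbb P^{2m}$ of lines in $E$ is smooth over $k$. Choose a basis $(u_0,u_1)$ of $U$ and a basis $(e_1,\dots,e_{2m+1})$ of $E$, let $b_0,b_1$ be the polar bilinear forms of $q_{u_0},q_{u_1}$, and let $\Omega=\sum_i \mathrm{Pf}_i(t_0,t_1)\,e_i$, where $\mathrm{Pf}_i\in k[t_0,t_1]$ is the Pfaffian of the matrix of $t_0b_0+t_1b_1$ with the $i$-th row and column deleted. Let $W\subseteq E$ be the radical subspace, i.e. the span of the coefficient vectors of the polynomial vector $\Omega$. Then $X$ contains a canonical $(m-2)$-plane $\Pi$ defined over $k$, namely $|W|\cap X$ with its reduced structure. That is, there is exactly one $k$-subspace $P\subseteq E$, of dimension $m-1$, such that for every choice of the two bases the plane $\Pi=|P|$ is contained in $X$ and is the reduced subscheme of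 $|W|\cap X$ (the radical of the sum of the homogeneous ideals of $|W|$ and $X$ is the ideal generated by the linear forms vanishing on $P$); moreover $g(P)=P$ for all $g\in\mathrm{GL}(E)$, $h\in \mathrm{GL}(U)$ with $q_{h(u)}(gx)=q_u(x)$ for all $u\in U$, $x\in E$. In particular ($m=2$), every quartic del Pezzo surface over $k$, i.e. every smooth complete intersection $X$ of two quadrics in $\mathbb P^4$ over $k$, has a canonical $k$-rational point, namely $\Pi$. -/

import Mathlib

open Module

noncomputable section

namespace QuadricPencil

/-- The Pfaffian of an alternating matrix over a ring of characteristic two: the sum, over all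
perfect matchings of the index set, of the product of the matched entries. A perfect matching is
encoded as a fixed-point-free involution `σ`, its edges as the pairs `(i, σ i)` with `i < σ i`.
In characteristic two the usual sign of a matching is equal to one. -/
def pfaffian {R ι : Type*} [CommRing R] [Fintype ι] [LinearOrder ι] (A : Matrix ι ι R) : R :=
  ∑ σ : Equiv.Perm ι with ∀ i, σ (σ i) = i ∧ σ i ≠ i, ∏ i with i < σ i, A i (σ i)

section Coordinates

variable {k E U : Type*} [Field k] [AddCommGroup E] [Module k E] [AddCommGroup U] [Module k U]
variable {n : ℕ}

/-- The element `∑_{i ≤ j} a_{ij} x_i x_j` of `k[x_1, …, x_n]` given by a quadratic form on `E`,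
where `x_1, …, x_n` are the coordinates dual to the basis `e`. -/
def quadraticPoly (e : Basis (Fin n) k E) (Q : QuadraticForm k E) : MvPolynomial (Fin n) k :=
  ∑ i, MvPolynomial.C (Q (e i)) * MvPolynomial.X i ^ 2 +
    ∑ i, ∑ j with i < j,
      MvPolynomial.C (QuadraticMap.polar Q (e i) (e j)) *
        (MvPolynomial.X i * MvPolynomial.X j)

/-- The homogeneous ideal that defines the base scheme `X = ⋂_a V(q_a)` in `|E|`. -/
def baseLocusIdeal (q : U →ₗ[k] QuadraticForm k E) (e : Basis (Fin n) k E) :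
    Ideal (MvPolynomial (Fin n) k) :=
  Ideal.span (Set.range fun a : U => quadraticPoly e (q a))

/-- The coordinate ring `k[x_1, …, x_n] / (I_X, x_i - 1)` of the affine chart
`X ∩ {x_i ≠ 0}` of the base scheme `X`. -/
abbrev ChartRing (q : U →ₗ[k] QuadraticForm k E) (e : Basis (Fin n) k E) (i : Fin n) : Type _ :=
  MvPolynomial (Fin n) k ⧸ (baseLocusIdeal q e ⊔ Ideal.span {MvPolynomial.X i - 1})

/-- The homogeneous ideal that defines the linear subspace `|P|` of `|E|`: it is generated by the
linear forms that vanish on `P`. -/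
def linearIdeal (e : Basis (Fin n) k E) (P : Submodule k E) : Ideal (MvPolynomial (Fin n) k) :=
  Ideal.span {f | ∃ φ : Dual k E, (∀ x ∈ P, φ x = 0) ∧
    f = ∑ i, MvPolynomial.C (φ (e i)) * MvPolynomial.X i}

/-- The matrix over `k[t_0, t_1]` of the alternating bilinear form `t_0 b_0 + t_1 b_1`, where
`b_0`, `b_1` are the polar forms of the members of the pencil given by the basis `u` of `U`. -/
def polarMatrix (q : U →ₗ[k] QuadraticForm k E) (u : Basis (Fin 2) k U) (e : Basis (Fin n) k E) :
    Matrix (Fin n) (Fin n) (MvPolynomial (Fin 2) k) :=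
  fun i j => ∑ a, MvPolynomial.C (QuadraticMap.polar (q (u a)) (e i) (e j)) * MvPolynomial.X a

/-- The `i`-th coordinate of the radical map `Ω = (Pf_1, …, Pf_n)`, a polynomial in `t_0, t_1`:
the Pfaffian of the matrix that arises by deleting the `i`-th row and the `i`-th column. -/
def radicalMap (q : U →ₗ[k] QuadraticForm k E) (u : Basis (Fin 2) k U) (e : Basis (Fin n) k E)
    (i : Fin n) : MvPolynomial (Fin 2) k :=
  pfaffian ((polarMatrix q u e).submatrix
    (Subtype.val : {j : Fin n // j ≠ i} → Fin n) (Subtype.val : {j : Fin n // j ≠ i} → Fin n))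

/-- The radical subspace `W` of `E`: the image of the linear map `(S^m U^∨)^∨ → E` given by
`Ω ∈ E ⊗ S^m U^∨`, that is, the span of the coefficient vectors of `Ω`. (For a finite field `k`
this can be larger than the span of the values of `Ω` at the `k`-points of `U`.) -/
def radicalSubspace (q : U →ₗ[k] QuadraticForm k E) (u : Basis (Fin 2) k U)
    (e : Basis (Fin n) k E) : Submodule k E :=
  Submodule.span k
    (Set.range fun d : Fin 2 →₀ ℕ => ∑ i, MvPolynomial.coeff d (radicalMap q u e i) • e i)

end Coordinates

/-- The pencil `q` is regular: its base scheme `X` is smooth over `k`, that is, the affine charts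
of `X` for some coordinate system (equivalently, for each one) are smooth over `k`. -/
def IsRegular {k E U : Type*} [Field k] [AddCommGroup E] [Module k E] [AddCommGroup U]
    [Module k U] (q : U →ₗ[k] QuadraticForm k E) : Prop :=
  ∃ (n : ℕ) (e : Basis (Fin n) k E), ∀ i : Fin n, Algebra.Smooth k (ChartRing q e i)

end QuadricPencil

end

/-! In characteristic two the polar forms are alternating, so on a space of odd dimension each has
an odd-dimensional radical. The argument works over an algebraic closure `K` of `k` and then
descends.

Smoothness of `X` enters only through infinitesimal lifting: a tangent vector `y` at a point `x` of
`X` extends to second order, so some `z` has `b_c(x, z) = q_c(y)` for both forms. If a member `C`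
were singular at a point of `X`, this would make `C` vanish on a hyperplane, hence split into two
linear forms, and its large singular locus leads to a contradiction (`not_singular_of_lift`). So no
nonzero member is singular at a point of `X`. A radical of dimension at least three would contain
such a singular point, so all radicals are lines (`IsRegularPair.finrank_ker`).

Hence `Ω`, which the pencil annihilates, vanishes nowhere. Write `w_0, …, w_m` for its coefficient
vectors. Then `b_0 w_0 = 0` and `b_0 w_{j+1} + b_1 w_j = 0`. By Kronecker's argument a nowhere
vanishing kernel vector has minimal degree, so the `w_j` are independent and `dim W = m + 1`. The
recursion and symmetry make `W` isotropic for all polar forms. It is thus maximal isotropic and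
contains every such chain, which makes it independent of the bases.

On `W` every `q_u` is additive and, as `k` is perfect, the square of a linear form. Let `l_0, l_1`
be the forms for a basis of `U`; then `P = ker l_0 ∩ ker l_1`. If they were dependent, the binary
forms `l_c(Ω)` of degree `m ≥ 1` would have a common zero `(s, t)`, and `Ω(s, t)` would be a point
of `X` where `s q_0 + t q_1` is singular. So `dim P = m - 1`. The squares `l_c ^ 2` also show that
`P` cuts out the reduced intersection. -/

noncomputable section

namespace QuadricPencil

/-! ### Pfaffians in characteristic two -/

section Pfaffian

variable {R ι : Type*} [CommRing R] [CharP R 2] [Fintype ι] [LinearOrder ι]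

/-- In characteristic two, the determinant of an alternating matrix is the square of its
Pfaffian. -/
theorem det_eq_pfaffian_sq (A : Matrix ι ι R) (hs : ∀ i j, A i j = A j i)
    (hd : ∀ i, A i i = 0) : A.det = pfaffian A ^ 2 := by
  have hsign : ∀ σ : Equiv.Perm ι, Equiv.Perm.sign σ • ∏ i, A (σ i) i = ∏ i, A (σ i) i := by
    intro σ
    rcases Int.units_eq_one_or (Equiv.Perm.sign σ) with h | h <;> simp [h, CharTwo.neg_eq]
  rw [Matrix.det_apply, Finset.sum_congr rfl fun σ _ => hsign σ,
    ← Finset.sum_filter_add_sum_filter_not _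
      (fun σ : Equiv.Perm ι => ∀ i, σ (σ i) = i ∧ σ i ≠ i)]
  -- By symmetry `σ` and `σ⁻¹` contribute equally and cancel in pairs. A self-inverse `σ` in this
  -- range has a fixed point, and its term contains a zero diagonal entry.
  have hnot : ∑ σ : Equiv.Perm ι with ¬ ∀ i, σ (σ i) = i ∧ σ i ≠ i, ∏ i, A (σ i) i = 0 := by
    refine Finset.sum_involution (fun σ _ => σ⁻¹) ?_ ?_ ?_ ?_
    · intro σ _
      have : ∏ i, A (σ⁻¹ i) i = ∏ i, A (σ i) i := by
        rw [← Equiv.prod_comp σ]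
        exact Finset.prod_congr rfl fun i _ => by
          rw [show σ⁻¹ (σ i) = i from σ.symm_apply_apply i, hs]
      rw [this, CharTwo.add_self_eq_zero]
    · intro σ hσ hne heq
      simp only [Finset.mem_filter, Finset.mem_univ, true_and] at hσ
      apply hσ
      intro i
      constructor
      · exact (congrArg (fun τ : Equiv.Perm ι => τ (σ i)) heq).symm.trans (σ.symm_apply_apply i)
      · intro hi
        exact hne (Finset.prod_eq_zero (Finset.mem_univ i) (by rw [hi, hd]))
    · intro σ hσ
      simp only [Finset.mem_filter, Finset.mem_univ, true_and] at hσ ⊢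
      contrapose! hσ
      intro i
      have h1 : σ⁻¹ (σ⁻¹ i) = i := (hσ i).1
      have h2 : σ⁻¹ i = σ i := by
        conv_rhs => rw [← h1]
        exact (σ.apply_symm_apply _).symm
      exact ⟨by rw [← h2]; exact σ.apply_symm_apply i, h2 ▸ (hσ i).2⟩
    · intro σ _
      simp
  rw [hnot, add_zero, pfaffian, CharTwo.sum_sq]
  refine Finset.sum_congr rfl fun σ hσ => ?_
  simp only [Finset.mem_filter, Finset.mem_univ, true_and] at hσ
  -- Each edge of the matching is met twice, once from either end, and both halves of the product
  -- are equal.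
  rw [← Finset.prod_filter_mul_prod_filter_not _ (fun i => i < σ i), sq]
  congr 1
  · exact Finset.prod_congr rfl fun i _ => hs _ _
  · refine Finset.prod_bij (fun i _ => σ i) ?_ ?_ ?_ ?_
    · intro i hi
      simp only [Finset.mem_filter, Finset.mem_univ, true_and, not_lt] at hi ⊢
      rw [(hσ i).1]
      exact lt_of_le_of_ne hi (hσ i).2
    · intro i _ j _ h
      exact σ.injective h
    · intro i hi
      simp only [Finset.mem_filter, Finset.mem_univ, true_and] at hi
      refine ⟨σ i, ?_, (hσ i).1⟩
      simp [(hσ i).1, hi.le]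
    · intro i _
      rw [(hσ i).1]

theorem two_mul_card_lt {σ : Equiv.Perm ι} (hσ : ∀ i, σ (σ i) = i ∧ σ i ≠ i) :
    2 * (Finset.univ.filter fun i => i < σ i).card = Fintype.card ι := by
  have h : (Finset.univ.filter fun i => ¬ i < σ i).card
      = (Finset.univ.filter fun i => i < σ i).card := by
    refine Finset.card_bij (fun i _ => σ i) ?_ ?_ ?_
    · intro i hi
      simp only [Finset.mem_filter, Finset.mem_univ, true_and, not_lt] at hi ⊢
      rw [(hσ i).1]
      exact lt_of_le_of_ne hi (hσ i).2
    · intro i _ j _ h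
      exact σ.injective h
    · intro i hi
      simp only [Finset.mem_filter, Finset.mem_univ, true_and] at hi
      refine ⟨σ i, ?_, (hσ i).1⟩
      simp [(hσ i).1, hi.le]
  have := Finset.card_filter_add_card_filter_not (s := (Finset.univ : Finset ι))
    (fun i => i < σ i)
  rw [h, Finset.card_univ] at this
  omega

theorem pfaffian_eq_zero_of_odd {R ι : Type*} [CommRing R] [Fintype ι] [LinearOrder ι]
    (A : Matrix ι ι R) (h : Odd (Fintype.card ι)) :
    pfaffian A = 0 := by
  rw [pfaffian, Finset.filter_false_of_mem, Finset.sum_empty]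
  intro σ _ hσ
  rw [← two_mul_card_lt hσ] at h
  exact (Nat.not_odd_iff_even.2 (even_two_mul _)) h

theorem pfaffian_map {R ι S : Type*} [CommRing R] [Fintype ι] [LinearOrder ι]
    [CommRing S] (f : R →+* S) (A : Matrix ι ι R) :
    pfaffian (A.map f) = f (pfaffian A) := by
  simp [pfaffian, map_sum, map_prod]

/-- Identifies the squares of the principal Pfaffians with diagonal cofactors. -/
theorem adjugate_diag {N : ℕ} {R : Type*} [CommRing R] (A : Matrix (Fin (N + 1)) (Fin (N + 1)) R)
    (i : Fin (N + 1)) :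
    A.adjugate i i = (A.submatrix (Subtype.val : {j // j ≠ i} → _)
      (Subtype.val : {j // j ≠ i} → _)).det := by
  rw [Matrix.adjugate_fin_succ_eq_det_submatrix, ← two_mul, pow_mul, neg_one_sq, one_pow, one_mul,
    ← Matrix.det_submatrix_equiv_self (finSuccAboveEquiv i)]
  rfl

/-- The vector of the Pfaffians of the principal minors of an alternating matrix of odd size lies
in its kernel. -/
theorem sum_mul_pfaffian_eq_zero {R : Type*} [CommRing R] [IsDomain R] [CharP R 2] {N : ℕ}
    (A : Matrix (Fin (N + 1)) (Fin (N + 1)) R) (hs : ∀ i j, A i j = A j i)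
    (hd : ∀ i, A i i = 0) (i : Fin (N + 1)) :
    ∑ j, A i j * pfaffian (A.submatrix (Subtype.val : {l // l ≠ j} → _)
      (Subtype.val : {l // l ≠ j} → _)) = 0 := by
  have hadj : ∀ j l, A.adjugate j l = A.adjugate l j := fun j l => by
    have := congrFun (congrFun A.adjugate_transpose l) j
    rwa [show A.transpose = A from Matrix.ext fun a b => hs b a] at this
  have hpf : ∀ j, pfaffian (A.submatrix (Subtype.val : {l // l ≠ j} → _)
      (Subtype.val : {l // l ≠ j} → _)) ^ 2 = A.adjugate j j := fun j => by
    rw [adjugate_diag]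
    exact (det_eq_pfaffian_sq _ (fun a b => hs _ _) fun a => hd _).symm
  -- It suffices to kill the square `∑ A i j ^ 2 * adj j j`. This is the diagonal entry of `A * adj
  -- A * A = det A • A`, which is zero since `A` is alternating.
  refine pow_eq_zero_iff (two_ne_zero) |>.1 ?_
  rw [CharTwo.sum_sq]
  simp only [mul_pow, hpf]
  have h0 : (A * A.adjugate * A) i i = 0 := by
    rw [Matrix.mul_adjugate]
    simp [hd]
  have h1 : (A * A.adjugate * A) i i = ∑ l, ∑ j, A i j * A i l * A.adjugate j l := by
    rw [Matrix.mul_apply]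
    refine Finset.sum_congr rfl fun l _ => ?_
    rw [Matrix.mul_apply, Finset.sum_mul]
    refine Finset.sum_congr rfl fun j _ => ?_
    rw [hs l i]; ring
  -- The summand is symmetric in `j` and `l`, so the off-diagonal terms cancel in pairs.
  have h2 : ∑ l, ∑ j, A i j * A i l * A.adjugate j l = ∑ j, A i j ^ 2 * A.adjugate j j := by
    rw [← Finset.sum_product', ← Finset.sum_filter_add_sum_filter_not _
      (fun p : Fin (N + 1) × Fin (N + 1) => p.1 = p.2)]
    have : ∑ p : Fin (N + 1) × Fin (N + 1) with ¬ p.1 = p.2,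
        A i p.2 * A i p.1 * A.adjugate p.2 p.1 = 0 := by
      refine Finset.sum_involution (fun p _ => p.swap) ?_ ?_ ?_ ?_
      · intro p _
        simp only [Prod.fst_swap, Prod.snd_swap]
        rw [hadj p.1 p.2, mul_comm (A i p.1), CharTwo.add_self_eq_zero]
      · intro p hp _ h
        simp only [Finset.mem_filter, Finset.mem_univ, true_and] at hp
        exact hp (congrArg Prod.snd h)
      · intro p hp
        simp only [Finset.mem_filter, Finset.mem_univ, true_and] at hp ⊢
        exact fun h => hp h.symm
      · intro p _
        simp
    erw [this]
    rw [add_zero]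
    symm
    refine Finset.sum_bij (fun j _ => (j, j)) ?_ ?_ ?_ ?_
    · intro j _; simp
    · intro j _ l _ h; exact congrArg Prod.fst h
    · rintro ⟨a, b⟩ h
      simp only [Finset.mem_filter] at h
      exact ⟨a, Finset.mem_univ _, by rw [show a = b from h.2]⟩
    · intro j _; simp only [sq]
  rw [← h2, ← h1, h0]

end Pfaffian

/-! ### From second-order lifting to nonsingularity -/

section Regular

theorem finrank_le_finrank_inf_ker_add_one {K V : Type*} [Field K] [AddCommGroup V] [Module K V]
    [FiniteDimensional K V] (N : Submodule K V) (ψ : Dual K V) :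
    finrank K N ≤ finrank K (N ⊓ LinearMap.ker ψ : Submodule K V) + 1 := by
  have h1 := LinearMap.finrank_range_add_finrank_ker (ψ.domRestrict N)
  have h2 : finrank K (LinearMap.range (ψ.domRestrict N)) ≤ 1 :=
    (Submodule.finrank_le _).trans (finrank_self K).le
  have h3 : finrank K (LinearMap.ker (ψ.domRestrict N))
      = finrank K (N ⊓ LinearMap.ker ψ : Submodule K V) := by
    rw [← Submodule.map_comap_subtype]
    exact (Submodule.finrank_map_subtype_eq N _).symm
  omega

theorem exists_smul_eq_of_ker_le_ker {K V : Type*} [Field K] [AddCommGroup V] [Module K V]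
    {f g : Dual K V} (h : LinearMap.ker f ≤ LinearMap.ker g) : ∃ c : K, c • f = g := by
  have := mem_span_of_iInf_ker_le_ker (L := fun _ : Unit => f) (K := g) (by simpa using h)
  rw [Set.range_const] at this
  exact Submodule.mem_span_singleton.1 this

variable {K V : Type*} [Field K] [IsAlgClosed K] [AddCommGroup V] [Module K V]
  [FiniteDimensional K V]

/-- Along `a + t b` the form is a quadratic polynomial in `t`, which has a root unless `b` is itself
isotropic. -/
theorem exists_isotropic (D : QuadraticForm K V) (N : Submodule K V) (hN : 2 ≤ finrank K N) :
    ∃ z ∈ N, z ≠ 0 ∧ D z = 0 := by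
  obtain ⟨a, ha⟩ := finrank_pos_iff_exists_ne_zero.1 (show 0 < finrank K N by omega)
  obtain ⟨b, hb⟩ := exists_linearIndependent_pair_of_one_lt_finrank (R := K) (M := N) hN ha
  have hab : ∀ s t : K, s • (a : V) + t • (b : V) = 0 → s = 0 ∧ t = 0 := by
    intro s t h
    exact LinearIndependent.pair_iff.1 hb s t (by ext; simpa using h)
  by_cases hDb : D b = 0
  · exact ⟨b, b.2, fun h => by simpa using hab 0 1 (by simp [h]), hDb⟩
  obtain ⟨t, ht⟩ := IsAlgClosed.exists_root
    (Polynomial.C (D b) * Polynomial.X ^ 2 + Polynomial.C (QuadraticMap.polar D a b) * Polynomial.X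
      + Polynomial.C (D a)) (by rw [Polynomial.degree_quadratic hDb]; norm_num)
  refine ⟨(a : V) + t • (b : V), N.add_mem a.2 (N.smul_mem _ b.2),
    fun h => by simpa using hab 1 t (by simpa using h), ?_⟩
  simp only [Polynomial.IsRoot.def, Polynomial.eval_add, Polynomial.eval_mul, Polynomial.eval_C,
    Polynomial.eval_pow, Polynomial.eval_X] at ht
  rw [QuadraticMap.map_add D, QuadraticMap.map_smul, QuadraticMap.polar_smul_right]
  simp only [smul_eq_mul]
  linear_combination ht

/-- The second vector is sought in a hyperplane that misses the first, which forces independence. -/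
theorem exists_isotropic_pair (D : QuadraticForm K V) (N : Submodule K V)
    (hN : 3 ≤ finrank K N) :
    ∃ z₁ ∈ N, ∃ z₂ ∈ N, D z₁ = 0 ∧ D z₂ = 0 ∧
      ∀ s t : K, s • z₁ + t • z₂ = 0 → s = 0 ∧ t = 0 := by
  obtain ⟨z₁, h₁, hz₁, hD₁⟩ := exists_isotropic D N (by omega)
  obtain ⟨ψ, hψ⟩ : ∃ ψ : Dual K V, ψ z₁ ≠ 0 := by
    by_contra! h
    exact hz₁ ((forall_dual_apply_eq_zero_iff K z₁).1 h)
  have := finrank_le_finrank_inf_ker_add_one N ψ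
  obtain ⟨z₂, h₂, hz₂, hD₂⟩ := exists_isotropic D (N ⊓ LinearMap.ker ψ) (by omega)
  refine ⟨z₁, h₁, z₂, h₂.1, hD₁, hD₂, fun s t h => ?_⟩
  have hs : s = 0 := by
    have := congrArg ψ h
    rw [map_add, map_smul, map_smul, show ψ z₂ = 0 from h₂.2] at this
    simpa [hψ] using this
  exact ⟨hs, by simpa [hs, hz₂] using h⟩

variable [CharP K 2]

/-- If first order deformations of the points of a pencil of quadrics extend to the second order,
then no member of the pencil is singular at a point of the base locus. -/
theorem not_singular_of_lift (C D : QuadraticForm K V) (hV : 5 ≤ finrank K V) (hC : C ≠ 0)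
    (H : ∀ x, x ≠ 0 → C x = 0 → D x = 0 → ∀ y, QuadraticMap.polar C x y = 0 →
      QuadraticMap.polar D x y = 0 →
      ∃ z, QuadraticMap.polar C x z = C y ∧ QuadraticMap.polar D x z = D y)
    (x : V) (hx : x ≠ 0) (hCx : C x = 0) (hDx : D x = 0)
    (hs : ∀ y, QuadraticMap.polar C x y = 0) : False := by
  -- The obstruction: where `C` is singular, the term `polar C x z` of the lift vanishes, so `C` is
  -- zero on all tangent vectors.
  have hvan : ∀ x, x ≠ 0 → C x = 0 → D x = 0 → (∀ y, QuadraticMap.polar C x y = 0) →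
      ∀ y, QuadraticMap.polar D x y = 0 → C y = 0 := by
    intro x hx h1 h2 h3 y hy
    obtain ⟨z, hz, -⟩ := H x hx h1 h2 y (h3 y) hy
    rw [← hz, h3]
  have hne : ∀ x, x ≠ 0 → C x = 0 → D x = 0 → (∀ y, QuadraticMap.polar C x y = 0) →
      ∃ y, QuadraticMap.polar D x y ≠ 0 := by
    intro x hx h1 h2 h3
    by_contra! h
    exact hC (QuadraticMap.ext fun y => hvan x hx h1 h2 h3 y (h y))
  obtain ⟨v', hv'⟩ := hne x hx hCx hDx hs
  set l : Dual K V := QuadraticMap.polarBilin D x with hl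
  have hlv' : l v' ≠ 0 := hv'
  obtain ⟨v, hv⟩ : ∃ v, l v = 1 := ⟨(l v')⁻¹ • v', by simp [hlv']⟩
  -- `C` vanishes on `ker l`. Expanding `C` at `y = (y - l y • v) + l y • v` leaves the factor `l y`
  -- times this linear form.
  set μ : Dual K V := QuadraticMap.polarBilin C v + C v • l with hμ
  have hCf : ∀ y, C y = l y * μ y := by
    intro y
    have h0 : C (y - l y • v) = 0 := by
      refine hvan x hx hCx hDx hs _ ?_
      change l _ = 0
      simp [hv]
    have h1 : C y = C ((y - l y • v) + l y • v) := by simp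
    have h2 : QuadraticMap.polar C v v = 0 := by
      rw [QuadraticMap.polar_self, two_smul, CharTwo.add_self_eq_zero]
    rw [h1, QuadraticMap.map_add C, h0, QuadraticMap.map_smul, QuadraticMap.polar_smul_right,
      QuadraticMap.polar_sub_left, QuadraticMap.polar_smul_left, h2,
      QuadraticMap.polar_comm C y v]
    simp only [hμ, smul_eq_mul, LinearMap.add_apply, LinearMap.smul_apply,
      QuadraticMap.polarBilin_apply_apply]
    ring
  have hl0 : l ≠ 0 := fun h => hlv' (by rw [h]; rfl)
  have hμ0 : μ ≠ 0 := fun h => hC (QuadraticMap.ext fun y => by rw [hCf, h]; simp)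
  -- `C = l μ` is singular along `N`, so the obstruction applies at every zero of `D` in `N`.
  set N : Submodule K V := LinearMap.ker l ⊓ LinearMap.ker μ with hN
  have hN3 : 3 ≤ finrank K N := by
    have h1 := finrank_le_finrank_inf_ker_add_one ⊤ l
    have h2 := finrank_le_finrank_inf_ker_add_one (⊤ ⊓ LinearMap.ker l) μ
    rw [top_inf_eq, ← hN] at h2
    rw [top_inf_eq, finrank_top] at h1
    omega
  have hNC : ∀ y ∈ N, C y = 0 := fun y hy => by rw [hCf, show l y = 0 from hy.1, zero_mul]
  have hNp : ∀ y ∈ N, ∀ w, QuadraticMap.polar C y w = 0 := by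
    intro y hy w
    rw [QuadraticMap.polar, hCf, hCf w, hNC y hy, map_add, map_add, show l y = 0 from hy.1,
      show μ y = 0 from hy.2]
    ring
  -- `l μ` vanishes on the kernel of `polar D y`, and a vector space is not the union of two proper
  -- subspaces.
  have hprop : ∀ y ∈ N, y ≠ 0 → D y = 0 →
      (∃ c : K, c • QuadraticMap.polarBilin D y = l) ∨
      (∃ c : K, c • QuadraticMap.polarBilin D y = μ) := by
    intro y hy hy0 hDy
    have hk : LinearMap.ker (QuadraticMap.polarBilin D y) ≤ LinearMap.ker l ∨
        LinearMap.ker (QuadraticMap.polarBilin D y) ≤ LinearMap.ker μ := by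
      by_contra! h
      obtain ⟨⟨a, ha, ha'⟩, ⟨b, hb, hb'⟩⟩ := And.imp SetLike.not_le_iff_exists.1
        SetLike.not_le_iff_exists.1 h
      rw [LinearMap.mem_ker] at ha' hb'
      have hz : ∀ w ∈ LinearMap.ker (QuadraticMap.polarBilin D y), l w * μ w = 0 :=
        fun w hw => by rw [← hCf]; exact hvan y hy0 (hNC y hy) hDy (hNp y hy) w hw
      have h1 := hz a ha
      have h2 := hz b hb
      have h3 := hz (a + b) (Submodule.add_mem _ ha hb)
      rw [mul_eq_zero, or_iff_right ha'] at h1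
      rw [mul_eq_zero, or_iff_left hb'] at h2
      rw [map_add, map_add, h1, h2, zero_add, add_zero, mul_eq_zero] at h3
      exact h3.elim ha' hb'
    refine hk.imp (fun h => ?_) fun h => ?_
    · exact exists_smul_eq_of_ker_le_ker h
    · exact exists_smul_eq_of_ker_le_ker h
  -- If two independent zeros of `D` in `N` belong to the same form `ν`, then `c₁ y₁ - c₂ y₂` is a
  -- zero of `D` with vanishing polar functional, against `hne`.
  have htwo : ∀ ν : Dual K V, ν ≠ 0 → (∀ y ∈ N, ν y = 0) → ∀ y₁ ∈ N, ∀ y₂ ∈ N, D y₁ = 0 →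
      D y₂ = 0 → (∀ s t : K, s • y₁ + t • y₂ = 0 → s = 0 ∧ t = 0) →
      (∃ c : K, c • QuadraticMap.polarBilin D y₁ = ν) →
      (∃ c : K, c • QuadraticMap.polarBilin D y₂ = ν) → False := by
    rintro ν hν hνN y₁ h₁ y₂ h₂ hD₁ hD₂ hind ⟨c₁, hc₁⟩ ⟨c₂, hc₂⟩
    have hc0 : c₁ ≠ 0 := by rintro rfl; exact hν (by rw [← hc₁, zero_smul])
    have h12 : QuadraticMap.polar D y₁ y₂ = 0 := by
      have := LinearMap.congr_fun hc₁ y₂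
      rw [hνN y₂ h₂] at this
      simpa [hc0] using this
    have hy0 : c₁ • y₁ - c₂ • y₂ ≠ 0 := fun h =>
      hc0 (hind c₁ (-c₂) (by rw [neg_smul, ← sub_eq_add_neg, h])).1
    have hyN : c₁ • y₁ - c₂ • y₂ ∈ N := N.sub_mem (N.smul_mem _ h₁) (N.smul_mem _ h₂)
    obtain ⟨w, hw⟩ := hne _ hy0 (hNC _ hyN) (by
      rw [sub_eq_add_neg, ← neg_smul, QuadraticMap.map_add D, QuadraticMap.map_smul,
        QuadraticMap.map_smul, QuadraticMap.polar_smul_left, QuadraticMap.polar_smul_right, hD₁,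
        hD₂, h12]
      simp) (hNp _ hyN)
    apply hw
    have e1 := LinearMap.congr_fun hc₁ w
    have e2 := LinearMap.congr_fun hc₂ w
    simp only [LinearMap.smul_apply, QuadraticMap.polarBilin_apply_apply] at e1 e2
    rw [QuadraticMap.polar_sub_left, QuadraticMap.polar_smul_left, QuadraticMap.polar_smul_left,
      e1, e2, sub_self]
  have hlN : ∀ y ∈ N, l y = 0 := fun y hy => hy.1
  have hμN : ∀ y ∈ N, μ y = 0 := fun y hy => hy.2
  obtain ⟨z₁, h₁, z₂, h₂, hD₁, hD₂, hind⟩ := exists_isotropic_pair D N hN3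
  have hz₁ : z₁ ≠ 0 := fun h => by simpa using hind 1 0 (by simp [h])
  have hz₂ : z₂ ≠ 0 := fun h => by simpa using hind 0 1 (by simp [h])
  have hz₃ : z₁ + z₂ ≠ 0 := fun h => by simpa using hind 1 1 (by simp [h])
  have hp : ∀ ν : Dual K V, ν ≠ 0 → (∀ y ∈ N, ν y = 0) →
      (∃ c : K, c • QuadraticMap.polarBilin D z₁ = ν) → QuadraticMap.polar D z₁ z₂ = 0 := by
    rintro ν hν hνN ⟨c, hc⟩
    have hc0 : c ≠ 0 := by rintro rfl; exact hν (by rw [← hc, zero_smul])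
    have := LinearMap.congr_fun hc z₂
    rw [hνN z₂ h₂] at this
    simpa [hc0] using this
  have hD₃ : D (z₁ + z₂) = 0 := by
    rw [QuadraticMap.map_add D, hD₁, hD₂, add_zero, zero_add]
    exact (hprop z₁ h₁ hz₁ hD₁).elim (hp l hl0 hlN) (hp μ hμ0 hμN)
  have h₃ := N.add_mem h₁ h₂
  have hind' : ∀ s t : K, s • z₁ + t • (z₁ + z₂) = 0 → s = 0 ∧ t = 0 := by
    intro s t h
    obtain ⟨a, b⟩ := hind (s + t) t (by rw [← h]; module)
    subst b
    exact ⟨by simpa using a, rfl⟩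
  have hind'' : ∀ s t : K, s • z₂ + t • (z₁ + z₂) = 0 → s = 0 ∧ t = 0 := by
    intro s t h
    obtain ⟨a, b⟩ := hind t (s + t) (by rw [← h]; module)
    subst a
    exact ⟨by simpa using b, rfl⟩
  -- Three pairwise independent zeros share two forms `l`, `μ`, so two of them have the same one.
  rcases hprop z₁ h₁ hz₁ hD₁ with a | a <;> rcases hprop z₂ h₂ hz₂ hD₂ with b | b <;>
    rcases hprop _ h₃ hz₃ hD₃ with c | c
  · exact htwo l hl0 hlN _ h₁ _ h₂ hD₁ hD₂ hind a b
  · exact htwo l hl0 hlN _ h₁ _ h₂ hD₁ hD₂ hind a b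
  · exact htwo l hl0 hlN _ h₁ _ h₃ hD₁ hD₃ hind' a c
  · exact htwo μ hμ0 hμN _ h₂ _ h₃ hD₂ hD₃ hind'' b c
  · exact htwo l hl0 hlN _ h₂ _ h₃ hD₂ hD₃ hind'' b c
  · exact htwo μ hμ0 hμN _ h₁ _ h₃ hD₁ hD₃ hind' a c
  · exact htwo μ hμ0 hμN _ h₁ _ h₂ hD₁ hD₂ hind a b
  · exact htwo μ hμ0 hμN _ h₁ _ h₂ hD₁ hD₂ hind a b

end Regular

/-! ### Regular pairs of forms and their radicals -/

section RegularPair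

/-- The radical of an alternating form on an odd-dimensional space is odd-dimensional. -/
theorem odd_finrank_ker_of_isAlt {K V : Type*} [Field K] [CharP K 2] [AddCommGroup V] [Module K V]
    [FiniteDimensional K V] (b : LinearMap.BilinForm K V) (hb : ∀ x, b x x = 0)
    (hV : Odd (finrank K V)) : Odd (finrank K (LinearMap.ker b)) := by
  have hsymm : ∀ x y, b x y = b y x := by
    intro x y
    have h := hb (x + y)
    simp only [map_add, LinearMap.add_apply, hb, zero_add, add_zero] at h
    exact CharTwo.add_eq_zero.1 ((add_comm _ _).trans h)
  obtain ⟨C, hC⟩ := Submodule.exists_isCompl (LinearMap.ker b)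
  have hsum := Submodule.finrank_add_eq_of_isCompl hC
  by_contra hodd
  rw [Nat.not_odd_iff_even] at hodd
  have hCodd : Odd (finrank K C) := by
    rw [← hsum] at hV
    rcases Nat.even_or_odd (finrank K C) with h | h
    · exact absurd hV (Nat.not_odd_iff_even.2 (hodd.add h))
    · exact h
  let c := finBasis K C
  let M : Matrix (Fin (finrank K C)) (Fin (finrank K C)) K := fun i j => b (c i) (c j)
  -- The Gram matrix on the complement is alternating of odd size, so its Pfaffian is zero. A null
  -- vector of it is orthogonal to the complement and to the radical, hence lies in both.
  have hdet : M.det = 0 := by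
    rw [det_eq_pfaffian_sq M (fun i j => hsymm _ _) (fun i => hb _),
      pfaffian_eq_zero_of_odd M (by simpa using hCodd)]
    simp
  obtain ⟨v, hv0, hv⟩ := Matrix.exists_mulVec_eq_zero_iff.2 hdet
  set z : C := ∑ j, v j • c j with hz
  have hz0 : z ≠ 0 := fun h => hv0 (funext fun j =>
    Fintype.linearIndependent_iff.1 c.linearIndependent v (by rw [← hz, h]) j)
  have hcz : ∀ i, b (c i) z = 0 := by
    intro i
    have := congrFun hv i
    simp only [Matrix.mulVec, dotProduct, Pi.zero_apply, M] at this
    rw [hz, AddSubmonoidClass.coe_finsetSum, map_sum, ← this]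
    exact Finset.sum_congr rfl fun j _ => by simp [mul_comm]
  have hCz : ∀ y : C, b y z = 0 := by
    intro y
    rw [← c.sum_repr y, AddSubmonoidClass.coe_finsetSum, map_sum, LinearMap.sum_apply]
    exact Finset.sum_eq_zero fun j _ => by simp [hcz]
  have hker : (z : V) ∈ LinearMap.ker b := by
    rw [LinearMap.mem_ker]
    ext y
    obtain ⟨r, hr, d, hd, rfl⟩ := Submodule.mem_sup.1
      (show y ∈ LinearMap.ker b ⊔ C by rw [hC.sup_eq_top]; trivial)
    rw [map_add, hsymm _ r, hsymm _ d, LinearMap.mem_ker.1 hr, hCz ⟨d, hd⟩]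
    simp
  exact hz0 (Subtype.ext (Submodule.disjoint_def.1 hC.disjoint _ hker z.2))

variable {K V : Type*} [Field K] [AddCommGroup V] [Module K V]

/-- The base locus of the pencil spanned by two quadratic forms is nowhere singular: at each of its
points the differentials of the two forms are linearly independent. -/
def IsRegularPair (Q₀ Q₁ : QuadraticForm K V) : Prop :=
  ∀ x, x ≠ 0 → Q₀ x = 0 → Q₁ x = 0 → ∀ s t : K,
    (∀ y, s * QuadraticMap.polar Q₀ x y + t * QuadraticMap.polar Q₁ x y = 0) → s = 0 ∧ t = 0

theorem polar_comb (Q₀ Q₁ : QuadraticForm K V) (s t : K) (x y : V) :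
    QuadraticMap.polar (s • Q₀ + t • Q₁) x y
      = s * QuadraticMap.polar Q₀ x y + t * QuadraticMap.polar Q₁ x y := by
  simp only [QuadraticMap.polar, add_apply, smul_apply, smul_eq_mul]
  ring

variable [IsAlgClosed K] [FiniteDimensional K V] [CharP K 2]

/-- A relation between the differentials at `x` says that the member `C = s Q₀ + t Q₁` is singular
at `x`. Together with `C`, one of `Q₀`, `Q₁` still spans the pencil, so the lifting property passes
to that pair. -/
theorem isRegularPair_of_lift (Q₀ Q₁ : QuadraticForm K V) (hV : 5 ≤ finrank K V)
    (hind : ∀ s t : K, s • Q₀ + t • Q₁ = 0 → s = 0 ∧ t = 0)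
    (H : ∀ x, x ≠ 0 → Q₀ x = 0 → Q₁ x = 0 → ∀ y, QuadraticMap.polar Q₀ x y = 0 →
      QuadraticMap.polar Q₁ x y = 0 →
      ∃ z, QuadraticMap.polar Q₀ x z = Q₀ y ∧ QuadraticMap.polar Q₁ x z = Q₁ y) :
    IsRegularPair Q₀ Q₁ := by
  intro x hx h₀ h₁ s t hst
  by_contra hne
  have hC : s • Q₀ + t • Q₁ ≠ 0 := fun h => hne (hind s t h)
  have hCval : ∀ x, (s • Q₀ + t • Q₁) x = s * Q₀ x + t * Q₁ x := fun x => rfl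
  by_cases hs : s = 0
  · have ht : t ≠ 0 := fun ht => hne ⟨hs, ht⟩
    refine not_singular_of_lift (s • Q₀ + t • Q₁) Q₀ hV hC ?_ x hx ?_ h₀ ?_
    · intro x hx hCx hx₀ y hCy hy₀
      rw [hCval] at hCx
      rw [polar_comb] at hCy
      obtain ⟨z, hz₀, hz₁⟩ := H x hx hx₀ (by simpa [hs, ht] using hCx) y hy₀
        (by simpa [hs, ht] using hCy)
      exact ⟨z, by rw [polar_comb, hCval, hz₀, hz₁], hz₀⟩
    · rw [hCval, h₀, h₁, mul_zero, mul_zero, add_zero]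
    · intro y; rw [polar_comb]; exact hst y
  · refine not_singular_of_lift (s • Q₀ + t • Q₁) Q₁ hV hC ?_ x hx ?_ h₁ ?_
    · intro x hx hCx hx₁ y hCy hy₁
      rw [hCval] at hCx
      rw [polar_comb] at hCy
      obtain ⟨z, hz₀, hz₁⟩ := H x hx (by simpa [hs, hx₁] using hCx) hx₁ y
        (by simpa [hs, hy₁] using hCy) hy₁
      exact ⟨z, by rw [polar_comb, hCval, hz₀, hz₁], hz₁⟩
    · rw [hCval, h₀, h₁, mul_zero, mul_zero, add_zero]
    · intro y; rw [polar_comb]; exact hst y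

/-- All members of a regular pencil in odd dimension have a one-dimensional radical. -/
theorem IsRegularPair.finrank_ker {Q₀ Q₁ : QuadraticForm K V} (hQ : IsRegularPair Q₀ Q₁)
    (hV : Odd (finrank K V)) {s t : K} (hst : ¬ (s = 0 ∧ t = 0)) :
    finrank K (LinearMap.ker (s • QuadraticMap.polarBilin Q₀ + t • QuadraticMap.polarBilin Q₁))
      = 1 := by
  set b := s • QuadraticMap.polarBilin Q₀ + t • QuadraticMap.polarBilin Q₁ with hb
  have hbv : ∀ x y, b x y = s * QuadraticMap.polar Q₀ x y + t * QuadraticMap.polar Q₁ x y :=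
    fun x y => rfl
  have hodd : Odd (finrank K (LinearMap.ker b)) := by
    refine odd_finrank_ker_of_isAlt b (fun x => ?_) hV
    rw [hbv, QuadraticMap.polar_self, QuadraticMap.polar_self, two_smul, two_smul,
      CharTwo.add_self_eq_zero, CharTwo.add_self_eq_zero]
    simp
  by_contra h1
  have h3 : 3 ≤ finrank K (LinearMap.ker b) := by
    obtain ⟨r, hr⟩ := hodd
    omega
  -- The member `s Q₀ + t Q₁` vanishes on the plane of two independent zeros in its radical. A
  -- second member `D` has a zero on this plane, which is then a base point where the first one is
  -- singular.
  obtain ⟨z₁, h₁, z₂, h₂, hC₁, hC₂, hind⟩ := exists_isotropic_pair (s • Q₀ + t • Q₁) _ h3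
  obtain ⟨D, hD⟩ : ∃ D : QuadraticForm K V, ∀ x, s * Q₀ x + t * Q₁ x = 0 → D x = 0 →
      Q₀ x = 0 ∧ Q₁ x = 0 := by
    by_cases hs : s = 0
    · have ht : t ≠ 0 := fun ht => hst ⟨hs, ht⟩
      exact ⟨Q₀, fun x h h' => ⟨h', by simpa [hs, ht] using h⟩⟩
    · exact ⟨Q₁, fun x h h' => ⟨by simpa [hs, h'] using h, h'⟩⟩
  have hli : LinearIndependent K ![z₁, z₂] := LinearIndependent.pair_iff.2 hind
  obtain ⟨x, hx, hx0, hDx⟩ := exists_isotropic D (Submodule.span K (Set.range ![z₁, z₂]))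
    (by rw [finrank_span_eq_card hli]; simp)
  have hxC : s * Q₀ x + t * Q₁ x = 0 ∧ x ∈ LinearMap.ker b := by
    rw [Matrix.range_cons, Matrix.range_cons, Matrix.range_empty, Set.union_empty] at hx
    obtain ⟨a, c, rfl⟩ := Submodule.mem_span_pair.1 hx
    refine ⟨?_, Submodule.add_mem _ (Submodule.smul_mem _ _ h₁) (Submodule.smul_mem _ _ h₂)⟩
    change (s • Q₀ + t • Q₁) (a • z₁ + c • z₂) = 0
    rw [QuadraticMap.map_add (s • Q₀ + t • Q₁), QuadraticMap.map_smul, QuadraticMap.map_smul, hC₁,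
      hC₂, QuadraticMap.polar_smul_left, QuadraticMap.polar_smul_right, polar_comb, ← hbv,
      LinearMap.mem_ker.1 h₁]
    simp
  obtain ⟨e₀, e₁⟩ := hD x hxC.1 hDx
  exact hst (hQ x hx0 e₀ e₁ s t fun y => by
    rw [← hbv, LinearMap.mem_ker.1 hxC.2, LinearMap.zero_apply])

end RegularPair

/-! ### Minimal kernel vectors of a linear pencil -/

section Kronecker

variable {K V V' : Type*} [Field K] [AddCommGroup V] [Module K V] [AddCommGroup V'] [Module K V']

theorem exists_eq_smul_of_finrank_le_one [FiniteDimensional K V] {N : Submodule K V}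
    (h : finrank K N ≤ 1) {x y : V} (hx : x ∈ N) (hy : y ∈ N) (hx0 : x ≠ 0) :
    ∃ c : K, y = c • x := by
  have h1 : finrank K N = 1 := le_antisymm h
    (finrank_pos_iff_exists_ne_zero.2 ⟨⟨x, hx⟩, fun h => hx0 (congrArg Subtype.val h)⟩)
  obtain ⟨c, hc⟩ := (finrank_eq_one_iff_of_nonzero' (⟨x, hx⟩ : N)
    (fun h => hx0 (congrArg Subtype.val h))).1 h1 ⟨y, hy⟩
  exact ⟨c, (congrArg Subtype.val hc).symm⟩

/-- The coefficients of a vector polynomial in the kernel of the pencil `β₀ + t β₁`. -/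
structure IsChain (β₀ β₁ : V →ₗ[K] V') (w : ℕ → V) : Prop where
  zero : β₀ (w 0) = 0
  succ : ∀ j, β₀ (w (j + 1)) + β₁ (w j) = 0

/-- After an index shift the coefficient of `s ^ (m - j) * t ^ (j + 1)` is `β₀ (w (j + 1)) + β₁ (w
j)`. The boundary terms vanish since `β₀ (w 0) = 0` and `w (m + 1) = 0`. -/
theorem IsChain.sum_mem_ker {β₀ β₁ : V →ₗ[K] V'} {w : ℕ → V} (hw : IsChain β₀ β₁ w) {m : ℕ}
    (hm : ∀ j, m < j → w j = 0) (s t : K) :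
    (s • β₀ + t • β₁) (∑ j ∈ Finset.range (m + 1), (s ^ (m - j) * t ^ j) • w j) = 0 := by
  have h1 : ∑ j ∈ Finset.range (m + 1), (s * (s ^ (m - j) * t ^ j)) • β₀ (w j)
      = ∑ j ∈ Finset.range (m + 1), (s ^ (m - j) * t ^ (j + 1)) • β₀ (w (j + 1)) := by
    rw [Finset.sum_range_succ', Finset.sum_range_succ _ m, hw.zero, hm (m + 1) (by omega)]
    simp only [map_zero, smul_zero, add_zero]
    refine Finset.sum_congr rfl fun j hj => ?_
    rw [Finset.mem_range] at hj
    rw [show m - j = (m - (j + 1)) + 1 by omega]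
    ring_nf
  rw [LinearMap.add_apply, LinearMap.smul_apply, LinearMap.smul_apply, map_sum, map_sum,
    Finset.smul_sum, Finset.smul_sum]
  simp only [map_smul, smul_smul]
  rw [h1, ← Finset.sum_add_distrib]
  refine Finset.sum_eq_zero fun j _ => ?_
  rw [show t * (s ^ (m - j) * t ^ j) = s ^ (m - j) * t ^ (j + 1) by ring, ← smul_add, hw.succ,
    smul_zero]

variable [IsAlgClosed K] [FiniteDimensional K V]

/-- A nowhere vanishing vector polynomial of degree `m` in the kernel of a pencil of linear maps of
corank one has minimal degree. -/
theorem IsChain.eq_zero_of_lt {β₀ β₁ : V →ₗ[K] V'} {w : ℕ → V} (hw : IsChain β₀ β₁ w) {m : ℕ}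
    (hm : ∀ j, m < j → w j = 0) (hker : ∀ t : K, finrank K (LinearMap.ker (β₀ + t • β₁)) ≤ 1)
    (hne : ∀ t : K, ∑ j ∈ Finset.range (m + 1), t ^ j • w j ≠ 0) (hwm : w m ≠ 0)
    {v : ℕ → V} (hv : IsChain β₀ β₁ v) (hvm : ∀ j, m ≤ j → v j = 0) : v = 0 := by
  let P : (ℕ → V) → Dual K V → Polynomial K := fun u φ =>
    ∑ j ∈ Finset.range (m + 1), Polynomial.monomial j (φ (u j))
  have hcoeff : ∀ u φ j, j ≤ m → (P u φ).coeff j = φ (u j) := by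
    intro u φ j hj
    simp only [P, Polynomial.finsetSum_coeff, Polynomial.coeff_monomial]
    rw [Finset.sum_ite_eq' _ j, if_pos (Finset.mem_range.2 (by omega))]
  have heval : ∀ u φ t, (P u φ).eval t = φ (∑ j ∈ Finset.range (m + 1), t ^ j • u j) := by
    intro u φ t
    simp [P, Polynomial.eval_finsetSum, mul_comm]
  have hmem : ∀ u, IsChain β₀ β₁ u → (∀ j, m < j → u j = 0) → ∀ t : K,
      ∑ j ∈ Finset.range (m + 1), t ^ j • u j ∈ LinearMap.ker (β₀ + t • β₁) := by
    intro u hu hum t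
    have := hu.sum_mem_ker hum 1 t
    simpa using this
  -- For each `t` both vectors lie on the same kernel line, so the minors vanish at every `t`, hence
  -- identically.
  have hminor : ∀ φ ψ, P w φ * P v ψ = P v φ * P w ψ := by
    intro φ ψ
    refine Polynomial.funext fun t => ?_
    obtain ⟨c, hc⟩ := exists_eq_smul_of_finrank_le_one (hker t) (hmem w hw hm t)
      (hmem v hv (fun j hj => hvm j hj.le) t) (hne t)
    rw [Polynomial.eval_mul, Polynomial.eval_mul, heval, heval, heval, heval, hc, map_smul,
      map_smul, smul_eq_mul, smul_eq_mul]
    ring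
  -- A generator of a proper ideal would have a root, and `w` would vanish there.
  have htop : Ideal.span (Set.range (P w)) = ⊤ := by
    by_contra hI
    obtain ⟨g, hg⟩ := (inferInstance : (Ideal.span (Set.range (P w))).IsPrincipal)
    have hgu : ¬ IsUnit g := fun h => hI (by
      rw [hg]; exact Ideal.span_singleton_eq_top.2 h)
    obtain ⟨t, ht⟩ : ∃ t, g.IsRoot t := by
      by_cases h0 : g = 0
      · exact ⟨0, by simp [h0]⟩
      · exact IsAlgClosed.exists_root g fun h => hgu (Polynomial.isUnit_iff_degree_eq_zero.2 h)
    refine hne t ((forall_dual_apply_eq_zero_iff K _).1 fun φ => ?_)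
    rw [← heval]
    have h1 : P w φ ∈ Ideal.span (Set.range (P w)) := Ideal.subset_span ⟨φ, rfl⟩
    rw [hg] at h1
    obtain ⟨a, ha⟩ := Ideal.mem_span_singleton'.1 h1
    rw [← ha, Polynomial.eval_mul, ht.eq_zero, mul_zero]
  -- Writing `1` as a combination of the coordinates of `w` turns the vanishing minors into `v = f
  -- w`.
  obtain ⟨f, hf⟩ : ∃ f : Polynomial K, ∀ ψ, P v ψ = f * P w ψ := by
    have : ∀ p ∈ Ideal.span (Set.range (P w)), ∃ f, ∀ ψ, p * P v ψ = f * P w ψ := by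
      intro p hp
      induction hp using Submodule.span_induction with
      | mem x hx =>
        obtain ⟨φ, rfl⟩ := hx
        exact ⟨P v φ, fun ψ => hminor φ ψ⟩
      | zero => exact ⟨0, by simp⟩
      | add x y _ _ hx hy =>
        obtain ⟨f, hf⟩ := hx
        obtain ⟨g, hg⟩ := hy
        exact ⟨f + g, fun ψ => by rw [add_mul, add_mul, hf, hg]⟩
      | smul a x _ hx =>
        obtain ⟨f, hf⟩ := hx
        exact ⟨a * f, fun ψ => by rw [smul_eq_mul, mul_assoc, hf, mul_assoc]⟩
    obtain ⟨f, hf⟩ := this 1 (by rw [htop]; trivial)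
    exact ⟨f, fun ψ => by rw [← hf, one_mul]⟩
  obtain ⟨φ, hφ⟩ : ∃ φ : Dual K V, φ (w m) ≠ 0 := by
    by_contra! h
    exact hwm ((forall_dual_apply_eq_zero_iff K _).1 h)
  -- A coordinate of `w` has degree `m`, whereas `v` has degree less than `m`.
  have hf0 : f = 0 := by
    by_contra hf0
    have h1 : m ≤ (P w φ).natDegree :=
      Polynomial.le_natDegree_of_ne_zero (by rwa [hcoeff _ _ _ le_rfl])
    have hPw : P w φ ≠ 0 := fun h => hφ (by rw [← hcoeff _ _ _ le_rfl, h, Polynomial.coeff_zero])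
    have h2 : (P v φ).natDegree = f.natDegree + (P w φ).natDegree := by
      rw [hf, Polynomial.natDegree_mul hf0 hPw]
    have h3 : (P v φ).natDegree ≤ m := Polynomial.natDegree_sum_le_of_forall_le _ _ fun j hj =>
      (Polynomial.natDegree_monomial_le _).trans (by rw [Finset.mem_range] at hj; omega)
    have h4 : (P v φ).natDegree = m := by omega
    have h5 : P v φ ≠ 0 := by rw [hf]; exact mul_ne_zero hf0 hPw
    apply h5
    rw [← Polynomial.leadingCoeff_eq_zero, Polynomial.leadingCoeff, h4, hcoeff _ _ _ le_rfl,
      hvm m le_rfl, map_zero]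
  funext j
  by_cases hj : m ≤ j
  · exact hvm j hj
  · refine (forall_dual_apply_eq_zero_iff K _).1 fun φ => ?_
    rw [← hcoeff v φ j (by omega), hf, hf0, zero_mul, Polynomial.coeff_zero]

/-- The coefficients of a nowhere vanishing vector polynomial in the kernel of a pencil of linear
maps of corank one are linearly independent. -/
theorem IsChain.linearIndependent {β₀ β₁ : V →ₗ[K] V'} {w : ℕ → V} (hw : IsChain β₀ β₁ w) {m : ℕ}
    (hm : ∀ j, m < j → w j = 0) (hker : ∀ t : K, finrank K (LinearMap.ker (β₀ + t • β₁)) ≤ 1)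
    (hne : ∀ t : K, ∑ j ∈ Finset.range (m + 1), t ^ j • w j ≠ 0) (hwm : w m ≠ 0) :
    LinearIndependent K fun j : Fin (m + 1) => w j := by
  have hw0 : w 0 ≠ 0 := by
    have := hne 0
    rw [Finset.sum_range_succ'] at this
    simpa using this
  rw [Fintype.linearIndependent_iff]
  intro g hg
  by_contra! hex
  let c : ℕ → K := fun j => if h : j < m + 1 then g ⟨j, h⟩ else 0
  have hc : ∑ j ∈ Finset.range (m + 1), c j • w j = 0 := by
    rw [← hg, Finset.sum_range]
    exact Finset.sum_congr rfl fun j _ => by simp only [c, dif_pos j.2]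
  obtain ⟨i, hi⟩ := hex
  have hci : c i ≠ 0 := by simpa only [c, dif_pos i.2] using hi
  classical
  obtain ⟨h, hh⟩ : ∃ h, h ∈ (Finset.range (m + 1)).filter (fun j => c j ≠ 0) ∧
      ∀ j ∈ (Finset.range (m + 1)).filter (fun j => c j ≠ 0), j ≤ h :=
    Finset.exists_max_image _ id ⟨i, by simp [hci]; omega⟩
  simp only [Finset.mem_filter, Finset.mem_range] at hh
  obtain ⟨⟨hhm, hch⟩, hmax⟩ := hh
  have hch' : ∑ j ∈ Finset.range (h + 1), c j • w j = 0 := by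
    rw [← hc]
    refine Finset.sum_subset (Finset.range_subset_range.2 (by omega)) fun j hj hj' => ?_
    rw [Finset.mem_range] at hj hj'
    by_contra hne
    have := hmax j ⟨hj, fun h0 => hne (by rw [h0, zero_smul])⟩
    omega
  -- The relation is read backwards as a polynomial `p` of degree `h`. In the product `u = p w`,
  -- again a chain, the coefficient `u h` is the relation itself.
  let p : ℕ → K := fun j => if j ≤ h then c (h - j) else 0
  let u : ℕ → V := fun i => ∑ x ∈ Finset.HasAntidiagonal.antidiagonal i, p x.1 • w x.2
  have hu : IsChain β₀ β₁ u := by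
    constructor
    · simp [u, hw.zero]
    · intro j
      simp only [u]
      rw [Finset.Nat.sum_antidiagonal_succ', map_add, map_smul, hw.zero, smul_zero, zero_add,
        map_sum, map_sum, ← Finset.sum_add_distrib]
      refine Finset.sum_eq_zero fun x _ => ?_
      rw [map_smul, map_smul, ← smul_add, hw.succ, smul_zero]
  have huh : u h = 0 := by
    rw [← hch']
    simp only [u]
    rw [← Finset.Nat.sum_antidiagonal_swap, Finset.Nat.sum_antidiagonal_eq_sum_range_succ_mk]
    refine Finset.sum_congr rfl fun j hj => ?_
    rw [Finset.mem_range] at hj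
    simp only [p, Prod.fst_swap, Prod.snd_swap]
    rw [if_pos (by omega), show h - (h - j) = j by omega]
  have hu0 : u 0 = c h • w 0 := by simp [u, p]
  have : u 0 = 0 := by
    rcases Nat.eq_zero_or_pos h with h0 | hpos
    · rw [← huh, h0]
    -- Since `u h = 0`, cutting `u` off below `h` keeps it a chain. Its degree is less than `m`, so
    -- it is zero, although `u 0 = c h • w 0`.
    · let v : ℕ → V := fun i => if i < h then u i else 0
      have hv : IsChain β₀ β₁ v := by
        constructor
        · simp only [v, if_pos hpos, hu.zero]
        · intro j
          simp only [v]
          rcases lt_trichotomy (j + 1) h with hj | hj | hj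
          · rw [if_pos hj, if_pos (by omega), hu.succ]
          · have h1 := hu.succ j
            rw [hj, huh, map_zero, zero_add] at h1
            rw [if_neg (by omega), if_pos (by omega), h1, map_zero, zero_add]
          · rw [if_neg (by omega), if_neg (by omega), map_zero, map_zero, zero_add]
      have := congrFun (hw.eq_zero_of_lt hm hker hne hwm hv
        fun j hj => if_neg (by omega)) 0
      simpa only [v, if_pos hpos, Pi.zero_apply] using this
  rw [hu0] at this
  exact (smul_ne_zero hch hw0) this

end Kronecker

/-! ### Quadratic forms as polynomials -/

section QuadraticPoly

variable {k E U : Type*} [Field k] [AddCommGroup E] [Module k E] [AddCommGroup U] [Module k U]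
variable {n : ℕ}

theorem quadraticPoly_add (e : Basis (Fin n) k E) (Q Q' : QuadraticForm k E) :
    quadraticPoly e (Q + Q') = quadraticPoly e Q + quadraticPoly e Q' := by
  simp only [quadraticPoly, add_apply, FunLike.coe_add, QuadraticMap.polar_add, map_add,
    add_mul, Finset.sum_add_distrib]
  ring

theorem quadraticPoly_smul (e : Basis (Fin n) k E) (c : k) (Q : QuadraticForm k E) :
    quadraticPoly e (c • Q) = MvPolynomial.C c * quadraticPoly e Q := by
  simp only [quadraticPoly, smul_apply, FunLike.coe_smul, QuadraticMap.polar_smul,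
    smul_eq_mul, map_mul, mul_add, Finset.mul_sum, mul_assoc]

/-- In characteristic two the polar form does not determine the quadratic form. A bilinear form with
`Q x = B x x`, in general not symmetric, takes its place in evaluations and base change. -/
theorem quadraticPoly_toQuadraticMap (e : Basis (Fin n) k E) (B : LinearMap.BilinForm k E) :
    quadraticPoly e (LinearMap.BilinMap.toQuadraticMap B)
      = ∑ i, ∑ j, MvPolynomial.C (B (e i) (e j)) * (MvPolynomial.X i * MvPolynomial.X j) := by
  set f : Fin n → Fin n → MvPolynomial (Fin n) k := fun i j =>
    MvPolynomial.C (B (e i) (e j)) * (MvPolynomial.X i * MvPolynomial.X j) with hf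
  have h1 : ∀ i, ∑ j, f i j = f i i + (∑ j with i < j, f i j + ∑ j with j < i, f i j) := by
    intro i
    rw [← Finset.sum_filter_add_sum_filter_not _ (fun j => i < j), add_left_comm]
    congr 1
    rw [← Finset.add_sum_erase (Finset.univ.filter fun j => ¬ i < j) _
      (show i ∈ _ by simp)]
    congr 1
    refine Finset.sum_congr ?_ fun _ _ => rfl
    ext j
    simp only [Finset.mem_erase, Finset.mem_filter, Finset.mem_univ, true_and, not_lt]
    exact ⟨fun h => lt_of_le_of_ne h.2 h.1, fun h => ⟨h.ne, h.le⟩⟩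
  have h2 : ∑ i, ∑ j with j < i, f i j = ∑ i, ∑ j with i < j, f j i :=
    Finset.sum_comm' (by simp)
  simp only [hf] at h1 h2
  simp only [h1, Finset.sum_add_distrib]
  rw [h2, ← Finset.sum_add_distrib, quadraticPoly]
  congr 1
  · exact Finset.sum_congr rfl fun i _ => by
      rw [LinearMap.BilinMap.toQuadraticMap_apply, sq]
  · refine Finset.sum_congr rfl fun i _ => ?_
    rw [← Finset.sum_add_distrib]
    refine Finset.sum_congr rfl fun j _ => ?_
    rw [LinearMap.BilinMap.polar_toQuadraticMap, map_add]
    ring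

theorem aeval_quadraticPoly {A : Type*} [CommRing A] [Algebra k A] (e : Basis (Fin n) k E)
    (B : LinearMap.BilinForm k E) (p : Fin n → A) :
    MvPolynomial.aeval p (quadraticPoly e (LinearMap.BilinMap.toQuadraticMap B))
      = ∑ i, ∑ j, algebraMap k A (B (e i) (e j)) * (p i * p j) := by
  simp [quadraticPoly_toQuadraticMap, map_sum]

/-- The ideal of the base scheme is generated by the members of a basis of the pencil. -/
theorem baseLocusIdeal_le_iff (q : U →ₗ[k] QuadraticForm k E) (u : Basis (Fin 2) k U)
    (e : Basis (Fin n) k E) (I : Ideal (MvPolynomial (Fin n) k)) :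
    baseLocusIdeal q e ≤ I ↔ ∀ c, quadraticPoly e (q (u c)) ∈ I := by
  rw [baseLocusIdeal, Ideal.span_le]
  constructor
  · exact fun h c => h ⟨u c, rfl⟩
  · rintro h _ ⟨a, rfl⟩
    dsimp only
    rw [← u.sum_repr a, Fin.sum_univ_two, map_add, map_smul, map_smul, quadraticPoly_add,
      quadraticPoly_smul, quadraticPoly_smul]
    exact I.add_mem (I.mul_mem_left _ (h 0)) (I.mul_mem_left _ (h 1))

end QuadraticPoly

/-! ### Smoothness and extension of scalars -/

section Smooth

variable {k E U : Type*} [Field k] [AddCommGroup E] [Module k E] [AddCommGroup U] [Module k U]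
variable {n : ℕ}

/-- First order deformations of points of a smooth affine chart extend to the second order. -/
theorem exists_second_order_lift {K : Type*} [Field K] [Algebra k K]
    (q : U →ₗ[k] QuadraticForm k E)
    (u : Basis (Fin 2) k U) (e : Basis (Fin n) k E) (B : Fin 2 → LinearMap.BilinForm k E)
    (hB : ∀ c, LinearMap.BilinMap.toQuadraticMap (B c) = q (u c)) (l : Fin n)
    [Algebra.FormallySmooth k (ChartRing q e l)] (x y : Fin n → K)
    (hx : ∀ c, ∑ i, ∑ j, algebraMap k K (B c (e i) (e j)) * (x i * x j) = 0)
    (hy : ∀ c, ∑ i, ∑ j, algebraMap k K (B c (e i) (e j)) * (x i * y j + y i * x j) = 0)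
    (hxl : x l = 1) (hyl : y l = 0) :
    ∃ z : Fin n → K, ∀ c, ∑ i, ∑ j, algebraMap k K (B c (e i) (e j)) *
      (x i * z j + y i * y j + z i * x j) = 0 := by
  let J : ℕ → Ideal (Polynomial K) := fun r => Ideal.span {Polynomial.X ^ r}
  have hJ : ∀ r (p : Polynomial K), p ∈ J r ↔ ∀ d < r, p.coeff d = 0 := fun r p => by
    rw [Ideal.mem_span_singleton, Polynomial.X_pow_dvd_iff]
  have hJ32 : J 3 ≤ J 2 := fun p hp => (hJ 2 p).2 fun d hd => (hJ 3 p).1 hp d (by omega)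
  have hcoe : ∀ (a : k) (p : Polynomial K) (d : ℕ),
      (algebraMap k (Polynomial K) a * p).coeff d = algebraMap k K a * p.coeff d := by
    intro a p d
    rw [← Algebra.smul_def, Polynomial.coeff_smul, Algebra.smul_def]
  -- The arc `x + y X`: by `hx` and `hy` it is a point of the chart modulo `X ^ 2`, and the
  -- normalisations `x l = 1`, `y l = 0` keep it in the chart.
  let p : Fin n → Polynomial K := fun i => Polynomial.C (x i) + Polynomial.C (y i) * Polynomial.X
  have hp0 : ∀ i, (p i).coeff 0 = x i := fun i => by simp [p]
  have hp1 : ∀ i, (p i).coeff 1 = y i := fun i => by simp [p]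
  have hmul1 : ∀ f g : Polynomial K, (f * g).coeff 1
      = f.coeff 0 * g.coeff 1 + f.coeff 1 * g.coeff 0 := fun f g => by
    rw [Polynomial.coeff_mul, Finset.Nat.antidiagonal_succ]
    simp
  have hmul2 : ∀ f g : Polynomial K, (f * g).coeff 2
      = f.coeff 0 * g.coeff 2 + f.coeff 1 * g.coeff 1 + f.coeff 2 * g.coeff 0 := fun f g => by
    simp only [Polynomial.coeff_mul, Finset.Nat.antidiagonal_succ]
    simp [add_assoc]
  let f₀ : MvPolynomial (Fin n) k →ₐ[k] Polynomial K ⧸ J 2 :=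
    (Ideal.Quotient.mkₐ k (J 2)).comp (MvPolynomial.aeval p)
  have hf₀ : baseLocusIdeal q e ⊔ Ideal.span {MvPolynomial.X l - 1} ≤ RingHom.ker f₀ := by
    refine sup_le ?_ ?_
    · rw [baseLocusIdeal_le_iff q u]
      intro c
      rw [RingHom.mem_ker, ← hB]
      change Ideal.Quotient.mk (J 2) (MvPolynomial.aeval p _) = 0
      rw [Ideal.Quotient.eq_zero_iff_mem, aeval_quadraticPoly, hJ]
      intro d hd
      simp only [Polynomial.finsetSum_coeff, hcoe]
      interval_cases d
      · simpa only [Polynomial.mul_coeff_zero, hp0] using hx c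
      · simpa only [hmul1, hp0, hp1] using hy c
    · rw [Ideal.span_singleton_le_iff_mem, RingHom.mem_ker]
      change Ideal.Quotient.mk (J 2) (MvPolynomial.aeval p _) = 0
      rw [Ideal.Quotient.eq_zero_iff_mem, hJ]
      intro d hd
      simp [p, hxl, hyl]
  let f : ChartRing q e l →ₐ[k] Polynomial K ⧸ J 2 := Ideal.Quotient.liftₐ _ f₀ fun a ha => hf₀ ha
  let g : (Polynomial K ⧸ J 3) →ₐ[k] Polynomial K ⧸ J 2 := Ideal.Quotient.factorₐ k hJ32
  have hg : Function.Surjective g := Ideal.Quotient.factor_surjective hJ32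
  -- The kernel is generated by `X ^ 2`, and `X ^ 4` is zero modulo `X ^ 3`.
  have hgn : IsNilpotent (RingHom.ker g) := by
    refine ⟨2, (sq (RingHom.ker g)).trans ?_⟩
    rw [Ideal.zero_eq_bot, eq_bot_iff, Ideal.mul_le]
    intro a ha b hb
    obtain ⟨a, rfl⟩ := Ideal.Quotient.mk_surjective a
    obtain ⟨b, rfl⟩ := Ideal.Quotient.mk_surjective b
    have h1 : a ∈ J 2 := Ideal.Quotient.eq_zero_iff_mem.1 ha
    have h2 : b ∈ J 2 := Ideal.Quotient.eq_zero_iff_mem.1 hb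
    rw [Ideal.mem_bot, ← map_mul, Ideal.Quotient.eq_zero_iff_mem, Ideal.mem_span_singleton]
    rw [Ideal.mem_span_singleton] at h1 h2
    exact (pow_dvd_pow _ (by norm_num)).trans
      ((pow_add (Polynomial.X : Polynomial K) 2 2).symm ▸ mul_dvd_mul h1 h2)
  let F : ChartRing q e l →ₐ[k] Polynomial K ⧸ J 3 :=
    Algebra.FormallySmooth.liftOfSurjective f g hg hgn
  have hF : ∀ a, g (F a) = f a := Algebra.FormallySmooth.liftOfSurjective_apply f g hg hgn
  choose P hP using fun i => Ideal.Quotient.mk_surjective (I := J 3)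
    (F (Ideal.Quotient.mk _ (MvPolynomial.X i)))
  have hPp : ∀ i, P i - p i ∈ J 2 := by
    intro i
    rw [← Ideal.Quotient.eq_zero_iff_mem, map_sub, sub_eq_zero]
    have h := hF (Ideal.Quotient.mk _ (MvPolynomial.X i))
    rw [← hP] at h
    refine h.trans ?_
    change Ideal.Quotient.mk (J 2) (MvPolynomial.aeval p _) = _
    rw [MvPolynomial.aeval_X]
  have hP0 : ∀ i, (P i).coeff 0 = x i := fun i => by
    have := (hJ _ _).1 (hPp i) 0 (by norm_num)
    rwa [Polynomial.coeff_sub, hp0, sub_eq_zero] at this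
  have hP1 : ∀ i, (P i).coeff 1 = y i := fun i => by
    have := (hJ _ _).1 (hPp i) 1 (by norm_num)
    rwa [Polynomial.coeff_sub, hp1, sub_eq_zero] at this
  -- The lift agrees with `x + y X` to first order. Its `X ^ 2` coefficients give `z`, and the
  -- equation is the `X ^ 2` coefficient of the form.
  refine ⟨fun i => (P i).coeff 2, fun c => ?_⟩
  have hcomp : (F.comp (Ideal.Quotient.mkₐ k _)) = (Ideal.Quotient.mkₐ k (J 3)).comp
      (MvPolynomial.aeval P) := by
    refine MvPolynomial.algHom_ext fun i => ?_
    change F (Ideal.Quotient.mk _ (MvPolynomial.X i)) =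
      Ideal.Quotient.mk (J 3) (MvPolynomial.aeval P (MvPolynomial.X i))
    rw [MvPolynomial.aeval_X, hP]
  have hc := DFunLike.congr_fun hcomp (quadraticPoly e (q (u c)))
  have h0 : F (Ideal.Quotient.mk _ (quadraticPoly e (q (u c)))) = 0 := by
    rw [Ideal.Quotient.eq_zero_iff_mem.2, map_zero]
    exact Ideal.mem_sup_left (Ideal.subset_span ⟨_, rfl⟩)
  have h1 : Ideal.Quotient.mk (J 3) (MvPolynomial.aeval P (quadraticPoly e (q (u c)))) = 0 :=
    hc.symm.trans h0
  rw [Ideal.Quotient.eq_zero_iff_mem, ← hB, aeval_quadraticPoly, hJ] at h1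
  have h2 := h1 2 (by norm_num)
  simpa only [Polynomial.finsetSum_coeff, hcoe, hmul2, hP0, hP1] using h2

/-- The quadratic form `x ↦ B x x` after extension of scalars. -/
def extForm (K : Type*) [Field K] [Algebra k K] (B : LinearMap.BilinForm k E) :
    QuadraticForm K (TensorProduct k K E) :=
  LinearMap.BilinMap.toQuadraticMap (B.baseChange K)

variable {K : Type*} [Field K] [Algebra k K]

theorem baseChange_apply_sum (e : Basis (Fin n) k E) (B : LinearMap.BilinForm k E)
    (x y : Fin n → K) :
    B.baseChange K (∑ i, x i • e.baseChange K i) (∑ i, y i • e.baseChange K i)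
      = ∑ i, ∑ j, algebraMap k K (B (e i) (e j)) * (x i * y j) := by
  rw [LinearMap.map_sum₂]
  refine Finset.sum_congr rfl fun i _ => ?_
  rw [map_sum]
  refine Finset.sum_congr rfl fun j _ => ?_
  simp only [map_smul, LinearMap.smul_apply, Basis.baseChange_apply,
    LinearMap.BilinForm.baseChange_tmul, Algebra.smul_def, mul_one]
  simp only [Algebra.algebraMap_self, RingHom.id_apply]
  ring

theorem extForm_sum (e : Basis (Fin n) k E) (B : LinearMap.BilinForm k E) (x : Fin n → K) :
    extForm K B (∑ i, x i • e.baseChange K i)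
      = ∑ i, ∑ j, algebraMap k K (B (e i) (e j)) * (x i * x j) :=
  baseChange_apply_sum e B x x

theorem polar_extForm_sum (e : Basis (Fin n) k E) (B : LinearMap.BilinForm k E)
    (x y : Fin n → K) :
    QuadraticMap.polar (extForm K B) (∑ i, x i • e.baseChange K i) (∑ i, y i • e.baseChange K i)
      = ∑ i, ∑ j, algebraMap k K (B (e i) (e j)) * (x i * y j + y i * x j) := by
  rw [extForm, LinearMap.BilinMap.polar_toQuadraticMap, baseChange_apply_sum,
    baseChange_apply_sum]
  simp only [mul_add, Finset.sum_add_distrib]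

theorem extForm_tmul (B : LinearMap.BilinForm k E) (a : K) (x : E) :
    extForm K B (a ⊗ₜ[k] x) = algebraMap k K (B x x) * a ^ 2 := by
  rw [extForm, LinearMap.BilinMap.toQuadraticMap_apply, LinearMap.BilinForm.baseChange_tmul,
    Algebra.smul_def, sq]

theorem polar_extForm_tmul (B : LinearMap.BilinForm k E) (a b : K) (x y : E) :
    QuadraticMap.polar (extForm K B) (a ⊗ₜ[k] x) (b ⊗ₜ[k] y)
      = algebraMap k K (QuadraticMap.polar (LinearMap.BilinMap.toQuadraticMap B) x y)
        * (a * b) := by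
  rw [extForm, LinearMap.BilinMap.polar_toQuadraticMap, LinearMap.BilinMap.polar_toQuadraticMap,
    LinearMap.BilinForm.baseChange_tmul,
    LinearMap.BilinForm.baseChange_tmul, Algebra.smul_def, Algebra.smul_def, map_add]
  ring

variable [IsAlgClosed K] [CharP K 2] [FiniteDimensional k E]

/-- The lifting criterion applies on the affine charts; what remains is to move a point and a
tangent vector of the cone into a chart. -/
theorem isRegularPair_extForm (q : U →ₗ[k] QuadraticForm k E) (hq : Function.Injective q)
    (hreg : IsRegular q) (hE : 5 ≤ finrank k E) (u : Basis (Fin 2) k U)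
    (B : Fin 2 → LinearMap.BilinForm k E)
    (hB : ∀ c, LinearMap.BilinMap.toQuadraticMap (B c) = q (u c)) :
    IsRegularPair (extForm K (B 0)) (extForm K (B 1)) := by
  refine isRegularPair_of_lift _ _ (by rwa [Module.finrank_baseChange]) ?_ ?_
  · intro s t hst
    have hval : ∀ x, s * algebraMap k K (q (u 0) x) + t * algebraMap k K (q (u 1) x) = 0 := by
      intro x
      have := QuadraticMap.congr_fun hst (1 ⊗ₜ x)
      rw [add_apply, smul_apply, smul_apply, extForm_tmul, extForm_tmul] at this
      rw [← hB, ← hB]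
      simpa using this
    -- Applying `k`-linear functionals of `K` to a relation over `K` gives relations over `k`.
    have key : ∀ φ : K →ₗ[k] k, φ s = 0 ∧ φ t = 0 := by
      intro φ
      have h1 : q (φ s • u 0 + φ t • u 1) = 0 := by
        ext x
        have := congrArg φ (hval x)
        rw [mul_comm s, mul_comm t, ← Algebra.smul_def, ← Algebra.smul_def, map_add, map_smul,
          map_smul, φ.map_zero] at this
        rw [map_add, map_smul, map_smul, add_apply, smul_apply, smul_apply, zero_apply]
        simp only [smul_eq_mul] at this ⊢
        linear_combination this
      have h2 := hq (h1.trans (map_zero q).symm)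
      exact LinearIndependent.pair_iff.1 (show LinearIndependent k ![u 0, u 1] by
        convert u.linearIndependent using 1
        ext c; fin_cases c <;> rfl) _ _ h2
    exact ⟨(forall_dual_apply_eq_zero_iff k s).1 fun φ => (key φ).1,
      (forall_dual_apply_eq_zero_iff k t).1 fun φ => (key φ).2⟩
  · obtain ⟨n, e, he⟩ := hreg
    intro x hx h₀ h₁ y hy₀ hy₁
    obtain ⟨l, hl⟩ : ∃ l, (e.baseChange K).repr x l ≠ 0 := by
      by_contra! h
      exact hx ((e.baseChange K).repr.map_eq_zero_iff.1 (Finsupp.ext h))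
    set a := (e.baseChange K).repr x l with ha
    have hx' : ∀ c, extForm K (B c) (a⁻¹ • x) = 0 := by
      intro c
      rw [QuadraticMap.map_smul]
      fin_cases c
      · simp [h₀]
      · simp [h₁]
    -- A multiple of `x` is removed so that the `l`-th coordinate vanishes. This changes no value,
    -- as `x` is a zero of the forms and orthogonal to `y`.
    set y' := y - (e.baseChange K).repr y l • a⁻¹ • x with hy'
    have hself : ∀ c, QuadraticMap.polar (extForm K (B c)) x x = 0 := by
      intro c
      rw [QuadraticMap.polar_self, two_smul, CharTwo.add_self_eq_zero]
    have hxy : ∀ c, QuadraticMap.polar (extForm K (B c)) x y = 0 := by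
      intro c
      fin_cases c
      · exact hy₀
      · exact hy₁
    have hp : ∀ c, QuadraticMap.polar (extForm K (B c)) (a⁻¹ • x) y' = 0 := by
      intro c
      rw [hy', QuadraticMap.polar_smul_left, QuadraticMap.polar_sub_right, smul_smul,
        QuadraticMap.polar_smul_right, hself, hxy]
      simp
    have hQy : ∀ c, extForm K (B c) y' = extForm K (B c) y := by
      intro c
      rw [hy', sub_eq_add_neg, QuadraticMap.map_add (extForm K (B c)), QuadraticMap.map_neg,
        QuadraticMap.map_smul, hx', QuadraticMap.polar_neg_right, smul_smul,
        QuadraticMap.polar_smul_right, QuadraticMap.polar_comm, hxy]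
      simp
    have := (he l).formallySmooth
    obtain ⟨z, hz⟩ := exists_second_order_lift q u e B hB l
      (fun i => (e.baseChange K).repr (a⁻¹ • x) i) (fun i => (e.baseChange K).repr y' i)
      (fun c => by rw [← extForm_sum, Basis.sum_repr, hx'])
      (fun c => by rw [← polar_extForm_sum, Basis.sum_repr, Basis.sum_repr, hp])
      (by simp [← ha, hl]) (by simp [hy', ← ha, hl])
    have hz' : ∀ c, QuadraticMap.polar (extForm K (B c)) x
        (a⁻¹ • ∑ i, z i • e.baseChange K i) = extForm K (B c) y := by
      intro c
      rw [QuadraticMap.polar_smul_right, ← QuadraticMap.polar_smul_left, ← hQy,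
        ← (e.baseChange K).sum_repr (a⁻¹ • x), polar_extForm_sum,
        ← (e.baseChange K).sum_repr y', extForm_sum, ← CharTwo.add_eq_zero, ← hz c]
      simp only [← Finset.sum_add_distrib]
      refine Finset.sum_congr rfl fun i _ => Finset.sum_congr rfl fun j _ => ?_
      ring
    exact ⟨_, hz' 0, hz' 1⟩

end Smooth

/-! ### The radical map and its coefficients -/

section RadicalMap

variable {k E U : Type*} [Field k] [AddCommGroup E] [Module k E] [AddCommGroup U] [Module k U]

theorem polar_self_eq_zero [CharP k 2] (Q : QuadraticForm k E) (x : E) :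
    QuadraticMap.polar Q x x = 0 := by
  rw [QuadraticMap.polar_self, two_smul, CharTwo.add_self_eq_zero]

/-- The exponent of the monomial `t₀ ^ a * t₁ ^ b`. -/
def bidegree (a b : ℕ) : Fin 2 →₀ ℕ := Finsupp.single 0 a + Finsupp.single 1 b

theorem bidegree_zero (a b : ℕ) : bidegree a b 0 = a := by simp [bidegree]

theorem bidegree_one (a b : ℕ) : bidegree a b 1 = b := by simp [bidegree]

theorem eq_bidegree (d : Fin 2 →₀ ℕ) : d = bidegree (d 0) (d 1) := by
  ext c
  fin_cases c
  · exact (bidegree_zero _ _).symm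
  · exact (bidegree_one _ _).symm

theorem bidegree_sub_zero (a b : ℕ) :
    bidegree (a + 1) b - Finsupp.single 0 1 = bidegree a b := by
  ext c
  fin_cases c <;> simp [bidegree]

theorem bidegree_sub_one (a b : ℕ) :
    bidegree a (b + 1) - Finsupp.single 1 1 = bidegree a b := by
  ext c
  fin_cases c <;> simp [bidegree]

theorem degree_bidegree (a b : ℕ) : (bidegree a b).degree = a + b := by
  simp [bidegree, map_add]

theorem aeval_eq_sum_of_isHomogeneous {K : Type*} [CommRing K] [Algebra k K] {m : ℕ}
    {p : MvPolynomial (Fin 2) k} (hp : p.IsHomogeneous m) (f : Fin 2 → K) :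
    MvPolynomial.aeval f p = ∑ j ∈ Finset.range (m + 1),
      algebraMap k K (p.coeff (bidegree (m - j) j)) * (f 0 ^ (m - j) * f 1 ^ j) := by
  classical
  have hinj : Set.InjOn (fun j => bidegree (m - j) j) (Finset.range (m + 1) : Set ℕ) := by
    intro i _ j _ h
    have := congrArg (fun d : Fin 2 →₀ ℕ => d 1) h
    simpa only [bidegree_one] using this
  rw [MvPolynomial.aeval_def, MvPolynomial.eval₂_eq']
  rw [Finset.sum_subset (s₂ := (Finset.range (m + 1)).image fun j => bidegree (m - j) j),
    Finset.sum_image hinj]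
  · refine Finset.sum_congr rfl fun j _ => ?_
    rw [Fin.prod_univ_two, bidegree_zero, bidegree_one]
  · intro d hd
    have hdeg : d.degree = m := by
      by_contra h
      exact MvPolynomial.mem_support_iff.1 hd (hp.coeff_eq_zero h)
    rw [eq_bidegree d, degree_bidegree] at hdeg
    rw [Finset.mem_image]
    refine ⟨d 1, Finset.mem_range.2 (by omega), ?_⟩
    conv_rhs => rw [eq_bidegree d]
    rw [← hdeg, Nat.add_sub_cancel]
  · intro d _ hd
    rw [MvPolynomial.notMem_support_iff.1 hd, map_zero, zero_mul]

/-- A perfect matching of the `2 m` remaining indices has `m` edges, and each contributes a linear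
form. -/
theorem radicalMap_isHomogeneous {m : ℕ} (q : U →ₗ[k] QuadraticForm k E) (u : Basis (Fin 2) k U)
    (e : Basis (Fin (2 * m + 1)) k E) (i : Fin (2 * m + 1)) :
    (radicalMap q u e i).IsHomogeneous m := by
  have hlin : ∀ a b, (polarMatrix q u e a b).IsHomogeneous 1 := fun a b =>
    MvPolynomial.IsHomogeneous.sum _ _ _ fun c _ => MvPolynomial.isHomogeneous_C_mul_X _ _
  rw [radicalMap, pfaffian]
  refine MvPolynomial.IsHomogeneous.sum _ _ _ fun σ hσ => ?_
  simp only [Finset.mem_filter, Finset.mem_univ, true_and] at hσ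
  have hcard := two_mul_card_lt hσ
  rw [Fintype.card_subtype_compl, Fintype.card_subtype_eq, Fintype.card_fin,
    Nat.add_sub_cancel] at hcard
  have hm : ∑ j : {j : Fin (2 * m + 1) // j ≠ i} with j < σ j, 1 = m := by
    rw [Finset.sum_const, smul_eq_mul, mul_one]
    omega
  have hprod := MvPolynomial.IsHomogeneous.prod
    (Finset.univ.filter fun j : {j : Fin (2 * m + 1) // j ≠ i} => j < σ j)
    (fun j => ((polarMatrix q u e).submatrix Subtype.val Subtype.val) j (σ j)) (fun _ => 1)
    (fun j _ => hlin _ _)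
  rwa [hm] at hprod

/-- The coefficient vector of `t₀ ^ a * t₁ ^ b` in the radical map. -/
def radicalCoeff {n : ℕ} (q : U →ₗ[k] QuadraticForm k E) (u : Basis (Fin 2) k U)
    (e : Basis (Fin n) k E) (a b : ℕ) : E :=
  ∑ i, (radicalMap q u e i).coeff (bidegree a b) • e i

/-- The coefficient vectors of the radical map, as a sequence. -/
def radicalSeq (m : ℕ) {n : ℕ} (q : U →ₗ[k] QuadraticForm k E) (u : Basis (Fin 2) k U)
    (e : Basis (Fin n) k E) (j : ℕ) : E :=
  if j ≤ m then radicalCoeff q u e (m - j) j else 0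

theorem radicalSubspace_eq_span {m : ℕ} (q : U →ₗ[k] QuadraticForm k E) (u : Basis (Fin 2) k U)
    (e : Basis (Fin (2 * m + 1)) k E) :
    radicalSubspace q u e
      = Submodule.span k (Set.range fun j : Fin (m + 1) => radicalSeq m q u e j) := by
  apply le_antisymm
  · rw [radicalSubspace, Submodule.span_le]
    rintro _ ⟨d, rfl⟩
    dsimp only
    by_cases hd : d.degree = m
    · refine Submodule.subset_span ⟨⟨d 1, ?_⟩, ?_⟩
      · rw [eq_bidegree d, degree_bidegree] at hd
        omega
      · rw [eq_bidegree d, degree_bidegree] at hd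
        dsimp only
        rw [radicalSeq, if_pos (by omega), radicalCoeff, show m - d 1 = d 0 by omega,
          ← eq_bidegree]
    · rw [Finset.sum_eq_zero]
      · exact Submodule.zero_mem _
      · intro i _
        rw [(radicalMap_isHomogeneous q u e i).coeff_eq_zero hd, zero_smul]
  · rw [Submodule.span_le]
    rintro _ ⟨j, rfl⟩
    refine Submodule.subset_span ⟨bidegree (m - j) j, ?_⟩
    dsimp only
    rw [radicalSeq, if_pos (by omega), radicalCoeff]

section Kernel

variable [CharP k 2]

theorem sum_polarMatrix_mul_radicalMap {m : ℕ} (q : U →ₗ[k] QuadraticForm k E)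
    (u : Basis (Fin 2) k U) (e : Basis (Fin (2 * m + 1)) k E) (i : Fin (2 * m + 1)) :
    ∑ j, polarMatrix q u e i j * radicalMap q u e j = 0 :=
  sum_mul_pfaffian_eq_zero (polarMatrix q u e)
    (fun i j => by simp only [polarMatrix, QuadraticMap.polar_comm _ (e i)])
    (fun i => by simp only [polarMatrix, polar_self_eq_zero, map_zero, zero_mul,
      Finset.sum_const_zero]) i

/-- The coefficient at `d` of the kernel identity for `Ω`. The case distinctions guard the truncated
subtraction of exponents. -/
theorem polar_radicalCoeff {m : ℕ} (q : U →ₗ[k] QuadraticForm k E)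
    (u : Basis (Fin 2) k U) (e : Basis (Fin (2 * m + 1)) k E) (d : Fin 2 →₀ ℕ) (y : E) :
    (if d 0 = 0 then 0 else QuadraticMap.polar (q (u 0)) (radicalCoeff q u e (d 0 - 1) (d 1)) y) +
      (if d 1 = 0 then 0 else
        QuadraticMap.polar (q (u 1)) (radicalCoeff q u e (d 0) (d 1 - 1)) y) = 0 := by
  have hcoeff : ∀ (p : MvPolynomial (Fin 2) k), (MvPolynomial.X 0 * p).coeff d
      = if d 0 = 0 then 0 else p.coeff (bidegree (d 0 - 1) (d 1)) := by
    intro p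
    rw [MvPolynomial.coeff_X_mul']
    by_cases h : d 0 = 0
    · simp [h]
    · rw [if_pos (Finsupp.mem_support_iff.2 h), if_neg h, ← bidegree_sub_zero,
        Nat.sub_add_cancel (Nat.pos_of_ne_zero h), ← eq_bidegree]
  have hcoeff' : ∀ (p : MvPolynomial (Fin 2) k), (MvPolynomial.X 1 * p).coeff d
      = if d 1 = 0 then 0 else p.coeff (bidegree (d 0) (d 1 - 1)) := by
    intro p
    rw [MvPolynomial.coeff_X_mul']
    by_cases h : d 1 = 0
    · simp [h]
    · rw [if_pos (Finsupp.mem_support_iff.2 h), if_neg h, ← bidegree_sub_one,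
        Nat.sub_add_cancel (Nat.pos_of_ne_zero h), ← eq_bidegree]
  have hpol : ∀ (Q : QuadraticForm k E) a b y, QuadraticMap.polar Q (radicalCoeff q u e a b) y
      = ∑ i, QuadraticMap.polar Q y (e i) * (radicalMap q u e i).coeff (bidegree a b) := by
    intro Q a b y
    rw [QuadraticMap.polar_comm, radicalCoeff, ← QuadraticMap.polarBilin_apply_apply, map_sum]
    refine Finset.sum_congr rfl fun i _ => ?_
    rw [map_smul, smul_eq_mul, mul_comm, QuadraticMap.polarBilin_apply_apply]
  have hbasis : ∀ i, (if d 0 = 0 then 0 else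
        QuadraticMap.polar (q (u 0)) (radicalCoeff q u e (d 0 - 1) (d 1)) (e i)) +
      (if d 1 = 0 then 0 else
        QuadraticMap.polar (q (u 1)) (radicalCoeff q u e (d 0) (d 1 - 1)) (e i)) = 0 := by
    intro i
    have h := congrArg (MvPolynomial.coeff d) (sum_polarMatrix_mul_radicalMap q u e i)
    simp only [polarMatrix, Fin.sum_univ_two, add_mul, mul_assoc, MvPolynomial.coeff_sum,
      MvPolynomial.coeff_add, MvPolynomial.coeff_C_mul, hcoeff, hcoeff', Finset.sum_add_distrib,
      MvPolynomial.coeff_zero] at h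
    rw [hpol, hpol]
    refine Eq.trans ?_ h
    congr 1
    · split_ifs <;> simp
    · split_ifs <;> simp
  let L : Dual k E :=
    (if d 0 = 0 then 0 else
      QuadraticMap.polarBilin (q (u 0)) (radicalCoeff q u e (d 0 - 1) (d 1))) +
    (if d 1 = 0 then 0 else
      QuadraticMap.polarBilin (q (u 1)) (radicalCoeff q u e (d 0) (d 1 - 1)))
  have hL : ∀ y, L y = (if d 0 = 0 then 0 else
        QuadraticMap.polar (q (u 0)) (radicalCoeff q u e (d 0 - 1) (d 1)) y) +
      (if d 1 = 0 then 0 else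
        QuadraticMap.polar (q (u 1)) (radicalCoeff q u e (d 0) (d 1 - 1)) y) := by
    intro y
    simp only [L, LinearMap.add_apply]
    congr 1 <;> split_ifs <;> rfl
  have hL0 : L = 0 := e.ext fun i => by rw [hL, hbasis, LinearMap.zero_apply]
  rw [← hL, hL0, LinearMap.zero_apply]

theorem isChain_radicalSeq {m : ℕ} (q : U →ₗ[k] QuadraticForm k E) (u : Basis (Fin 2) k U)
    (e : Basis (Fin (2 * m + 1)) k E) :
    IsChain (QuadraticMap.polarBilin (q (u 0))) (QuadraticMap.polarBilin (q (u 1)))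
      (radicalSeq m q u e) := by
  constructor
  · ext y
    have := polar_radicalCoeff q u e (bidegree (m + 1) 0) y
    rw [bidegree_zero, bidegree_one] at this
    simpa [radicalSeq] using this
  · intro j
    ext y
    rw [LinearMap.add_apply]
    rcases lt_trichotomy j m with hj | rfl | hj
    · have := polar_radicalCoeff q u e (bidegree (m - j) (j + 1)) y
      rw [bidegree_zero, bidegree_one, if_neg (by omega), if_neg (by omega)] at this
      rw [radicalSeq, radicalSeq, if_pos (by omega), if_pos hj.le]
      exact this
    · have := polar_radicalCoeff q u e (bidegree 0 (j + 1)) y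
      rw [bidegree_zero, bidegree_one] at this
      simpa [radicalSeq] using this
    · simp [radicalSeq, show ¬ j + 1 ≤ m by omega, show ¬ j ≤ m by omega]

end Kernel

variable {K : Type*} [Field K] [Algebra k K]

theorem isChain_tmul {q₀ q₁ : QuadraticForm k E} {B₀ B₁ : LinearMap.BilinForm k E}
    (h₀ : LinearMap.BilinMap.toQuadraticMap B₀ = q₀)
    (h₁ : LinearMap.BilinMap.toQuadraticMap B₁ = q₁) {w : ℕ → E}
    (hw : IsChain (QuadraticMap.polarBilin q₀) (QuadraticMap.polarBilin q₁) w) :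
    IsChain (QuadraticMap.polarBilin (extForm K B₀)) (QuadraticMap.polarBilin (extForm K B₁))
      (fun j => (1 : K) ⊗ₜ[k] w j) := by
  subst h₀ h₁
  constructor
  · ext z
    have := LinearMap.congr_fun hw.zero z
    rw [QuadraticMap.polarBilin_apply_apply, LinearMap.zero_apply] at this
    change QuadraticMap.polar (extForm K B₀) (1 ⊗ₜ w 0) (1 ⊗ₜ z) = 0
    rw [polar_extForm_tmul, this, map_zero, zero_mul]
  · intro j
    ext z
    have := LinearMap.congr_fun (hw.succ j) z
    rw [LinearMap.add_apply, QuadraticMap.polarBilin_apply_apply,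
      QuadraticMap.polarBilin_apply_apply, LinearMap.zero_apply] at this
    change QuadraticMap.polar (extForm K B₀) (1 ⊗ₜ w (j + 1)) (1 ⊗ₜ z) +
      QuadraticMap.polar (extForm K B₁) (1 ⊗ₜ w j) (1 ⊗ₜ z) = 0
    rw [polar_extForm_tmul, polar_extForm_tmul, ← add_mul, ← map_add, this, map_zero, zero_mul]

/-- The principal minor of a symmetric matrix of corank one at a nonzero entry of a kernel vector
does not vanish. -/
theorem det_submatrix_ne_zero {n : ℕ} {S : Matrix (Fin n) (Fin n) K} (hS : ∀ i j, S i j = S j i)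
    {v : Fin n → K} (hv : S.mulVec v = 0) (hker : ∀ z, S.mulVec z = 0 → ∃ c : K, z = c • v)
    {i : Fin n} (hi : v i ≠ 0) :
    (S.submatrix (Subtype.val : {j // j ≠ i} → _) (Subtype.val : {j // j ≠ i} → _)).det ≠ 0 := by
  intro hdet
  obtain ⟨z, hz0, hz⟩ := Matrix.exists_mulVec_eq_zero_iff.2 hdet
  -- Extended by zero, `z` is mapped by `S` to a multiple of the `i`-th unit vector. Pairing with
  -- `v` shows that this multiple is zero, so `z' = c v`, and the `i`-th entry gives `c = 0`.
  let z' : Fin n → K := fun j => if h : j ≠ i then z ⟨j, h⟩ else 0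
  have hsum : ∀ l, S.mulVec z' l = ∑ j : {j // j ≠ i}, S l j * z j := by
    intro l
    rw [Matrix.mulVec, dotProduct, ← Fintype.sum_subtype_add_sum_subtype (fun j => j ≠ i)]
    rw [Finset.sum_congr rfl fun (j : {j // ¬ j ≠ i}) _ =>
      show S l j * z' j = 0 by rw [show z' j = 0 from dif_neg j.2, mul_zero]]
    rw [Finset.sum_const_zero, add_zero]
    exact Finset.sum_congr rfl fun j _ => by rw [show z' j = z j from dif_pos j.2]
  have hne : ∀ l, l ≠ i → S.mulVec z' l = 0 := fun l hl => by
    rw [hsum]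
    exact congrFun hz ⟨l, hl⟩
  have hdot : ∑ l, v l * S.mulVec z' l = 0 := by
    change v ⬝ᵥ S.mulVec z' = 0
    rw [Matrix.dotProduct_mulVec, ← Matrix.mulVec_transpose,
      show S.transpose = S from Matrix.ext fun a b => hS b a, hv, zero_dotProduct]
  have hSi : S.mulVec z' i = 0 := by
    rw [Finset.sum_eq_single i (fun l _ hl => by rw [hne l hl, mul_zero]) (by simp)] at hdot
    exact (mul_eq_zero.1 hdot).resolve_left hi
  obtain ⟨c, hc⟩ := hker z' (funext fun l => by
    by_cases hl : l = i
    · rw [hl, hSi, Pi.zero_apply]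
    · exact hne l hl)
  have hc0 : c = 0 := by
    have := congrFun hc i
    rw [show z' i = 0 from dif_neg (by simp), Pi.smul_apply, smul_eq_mul] at this
    exact (mul_eq_zero.1 this.symm).resolve_right hi
  apply hz0
  ext j
  have := congrFun hc j
  rw [show z' j = z j from dif_pos j.2, hc0, zero_smul] at this
  exact this

variable [IsAlgClosed K] [CharP K 2]

/-- The radical map of a regular pencil vanishes nowhere. -/
theorem sum_radicalSeq_ne_zero {m : ℕ} (q : U →ₗ[k] QuadraticForm k E) (u : Basis (Fin 2) k U)
    (e : Basis (Fin (2 * m + 1)) k E) (B : Fin 2 → LinearMap.BilinForm k E)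
    (hB : ∀ c, LinearMap.BilinMap.toQuadraticMap (B c) = q (u c))
    (hR : IsRegularPair (extForm K (B 0)) (extForm K (B 1))) {s t : K}
    (hst : ¬ (s = 0 ∧ t = 0)) :
    ∑ j ∈ Finset.range (m + 1), (s ^ (m - j) * t ^ j) • ((1 : K) ⊗ₜ[k] radicalSeq m q u e j)
      ≠ 0 := by
  have : FiniteDimensional k E := e.finiteDimensional_of_finite
  set b := s • QuadraticMap.polarBilin (extForm K (B 0)) +
    t • QuadraticMap.polarBilin (extForm K (B 1)) with hb
  have hb1 : finrank K (LinearMap.ker b) = 1 := hR.finrank_ker (by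
    rw [Module.finrank_baseChange, finrank_eq_card_basis e, Fintype.card_fin]
    exact odd_two_mul_add_one m) hst
  have hbsymm : ∀ x y, b x y = b y x := fun x y => by
    simp only [hb, LinearMap.add_apply, LinearMap.smul_apply, QuadraticMap.polarBilin_apply_apply,
      QuadraticMap.polar_comm _ x]
  let S : Matrix (Fin (2 * m + 1)) (Fin (2 * m + 1)) K :=
    (polarMatrix q u e).map (MvPolynomial.aeval ![s, t]).toRingHom
  have hS : ∀ i j, S i j = b (e.baseChange K i) (e.baseChange K j) := by
    intro i j
    simp only [S, hb, Matrix.map_apply, polarMatrix, LinearMap.add_apply, LinearMap.smul_apply,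
      QuadraticMap.polarBilin_apply_apply, Basis.baseChange_apply, polar_extForm_tmul, hB]
    simp [Fin.sum_univ_two, mul_comm]
  have hSv : ∀ z : Fin (2 * m + 1) → K, ∀ i,
      S.mulVec z i = b (e.baseChange K i) (∑ j, z j • e.baseChange K j) := by
    intro z i
    rw [map_sum, Matrix.mulVec, dotProduct]
    exact Finset.sum_congr rfl fun j _ => by rw [hS, map_smul, smul_eq_mul, mul_comm]
  obtain ⟨⟨x, hx⟩, hx0⟩ := (finrank_pos_iff_exists_ne_zero (R := K)
    (M := LinearMap.ker b)).1 (by rw [hb1]; exact one_pos)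
  have hx0' : x ≠ 0 := fun h => hx0 (Subtype.ext h)
  obtain ⟨i, hi⟩ : ∃ i, (e.baseChange K).repr x i ≠ 0 := by
    by_contra! h
    exact hx0' ((e.baseChange K).repr.map_eq_zero_iff.1 (Finsupp.ext h))
  have hdet := det_submatrix_ne_zero (S := S) (v := fun j => (e.baseChange K).repr x j)
    (fun i j => by rw [hS, hS, hbsymm])
    (funext fun i => by
      rw [hSv, Basis.sum_repr, hbsymm, LinearMap.mem_ker.1 hx, LinearMap.zero_apply,
        Pi.zero_apply])
    (fun z hz => by
      have hy : ∑ j, z j • e.baseChange K j ∈ LinearMap.ker b := by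
        rw [LinearMap.mem_ker]
        refine (e.baseChange K).ext fun i => ?_
        rw [hbsymm, ← hSv, hz, Pi.zero_apply, LinearMap.zero_apply]
      obtain ⟨c, hc⟩ := exists_eq_smul_of_finrank_le_one hb1.le hx hy hx0'
      refine ⟨c, funext fun j => ?_⟩
      have := congrArg (fun y => (e.baseChange K).repr y j) hc
      rwa [Basis.repr_sum_self, map_smul, Finsupp.smul_apply] at this)
    hi
  -- The square of this Pfaffian is the principal minor at an index where the radical vector is
  -- nonzero.
  have hpf : MvPolynomial.aeval ![s, t] (radicalMap q u e i) ≠ 0 := by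
    intro h0
    apply hdet
    refine (det_eq_pfaffian_sq _ ?_ ?_).trans ?_
    rotate_left 2
    · rw [show S.submatrix (Subtype.val : {j // j ≠ i} → _) (Subtype.val : {j // j ≠ i} → _)
        = ((polarMatrix q u e).submatrix (Subtype.val : {j // j ≠ i} → _)
          (Subtype.val : {j // j ≠ i} → _)).map (MvPolynomial.aeval ![s, t]).toRingHom from rfl,
        pfaffian_map]
      change (MvPolynomial.aeval ![s, t] (radicalMap q u e i)) ^ 2 = 0
      rw [h0, sq, mul_zero]
    · intro a c
      rw [Matrix.submatrix_apply, Matrix.submatrix_apply, hS, hS, hbsymm]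
    · intro a
      rw [Matrix.submatrix_apply, hS]
      simp only [hb, LinearMap.add_apply, LinearMap.smul_apply,
        QuadraticMap.polarBilin_apply_apply, polar_self_eq_zero, smul_zero, add_zero]
  intro h0
  apply hpf
  have hrepr := congrArg (fun y => (e.baseChange K).repr y i) h0
  simp only [map_sum, map_smul, Finsupp.coe_finsetSum, Finset.sum_apply, Finsupp.smul_apply,
    Basis.baseChange_repr_tmul, map_zero, Finsupp.zero_apply] at hrepr
  rw [aeval_eq_sum_of_isHomogeneous (radicalMap_isHomogeneous q u e i), ← hrepr]
  refine Finset.sum_congr rfl fun j hj => ?_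
  rw [Finset.mem_range] at hj
  rw [radicalSeq, if_pos (by omega), radicalCoeff, Basis.repr_sum_self, smul_eq_mul, Algebra.smul_def,
    mul_one, mul_comm]
  rfl

end RadicalMap

/-! ### Chains and isotropic subspaces -/

section Chains

variable {k E : Type*} [Field k] [AddCommGroup E] [Module k E]

/-- By the recursion and symmetry, `β₀ (w (i + 1)) (w j) = β₀ (w i) (w (j + 1))`. The first index
can be lowered to `0`, where `β₀ (w 0) = 0`. -/
theorem IsChain.isotropic {β₀ β₁ : LinearMap.BilinForm k E} (h₁ : ∀ x y, β₁ x y = β₁ y x)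
    (h₀ : ∀ x y, β₀ x y = β₀ y x) {w : ℕ → E} (hw : IsChain β₀ β₁ w) (i j : ℕ) :
    β₀ (w i) (w j) = 0 ∧ β₁ (w i) (w j) = 0 := by
  have hstep : ∀ i y, β₀ (w (i + 1)) y + β₁ (w i) y = 0 := fun i y =>
    LinearMap.congr_fun (hw.succ i) y
  have key : ∀ i j, β₀ (w i) (w j) = 0 := by
    intro i
    induction i with
    | zero => intro j; rw [hw.zero, LinearMap.zero_apply]
    | succ i ih =>
      intro j
      have e1 := hstep i (w j)
      have e2 := hstep j (w i)
      rw [h₁ (w j), h₀ (w (j + 1)), ih, zero_add] at e2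
      rwa [e2, add_zero] at e1
  refine ⟨key i j, ?_⟩
  have := hstep i (w j)
  rwa [key, zero_add] at this

theorem isotropic_span {ι : Type*} {β : LinearMap.BilinForm k E} {w : ι → E}
    (h : ∀ i j, β (w i) (w j) = 0) {x y : E} (hx : x ∈ Submodule.span k (Set.range w))
    (hy : y ∈ Submodule.span k (Set.range w)) : β x y = 0 := by
  induction hx using Submodule.span_induction with
  | mem x hx =>
    obtain ⟨i, rfl⟩ := hx
    induction hy using Submodule.span_induction with
    | mem y hy => obtain ⟨j, rfl⟩ := hy; exact h i j
    | zero => rw [map_zero]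
    | add y z _ _ h1 h2 => rw [map_add, h1, h2, add_zero]
    | smul c y _ h1 => rw [map_smul, h1, smul_zero]
  | zero => rw [map_zero, LinearMap.zero_apply]
  | add x z _ _ h1 h2 => rw [map_add, LinearMap.add_apply, h1, h2, add_zero]
  | smul c x _ h1 => rw [map_smul, LinearMap.smul_apply, h1, smul_zero]

theorem map_sum_of_isotropic {ι : Type*} (Q : QuadraticForm k E) (s : Finset ι) (x : ι → E)
    (h : ∀ i j, QuadraticMap.polar Q (x i) (x j) = 0) : Q (∑ i ∈ s, x i) = ∑ i ∈ s, Q (x i) := by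
  classical
  induction s using Finset.induction_on with
  | empty => simp
  | insert a s ha ih =>
    have hpol : QuadraticMap.polar Q (x a) (∑ i ∈ s, x i) = 0 := by
      rw [← QuadraticMap.polarBilin_apply_apply, map_sum]
      exact Finset.sum_eq_zero fun i _ => h a i
    rw [Finset.sum_insert ha, Finset.sum_insert ha, QuadraticMap.map_add Q, ih, hpol, add_zero]

variable [FiniteDimensional k E]

/-- An isotropic subspace of the maximal possible dimension is its own orthogonal complement. -/
theorem mem_of_isotropic {m : ℕ} {b : LinearMap.BilinForm k E} (hb : ∀ x y, b x y = b y x)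
    (hE : finrank k E = 2 * m + 1) (hker : finrank k (LinearMap.ker b) ≤ 1) {N : Submodule k E}
    (hN : finrank k N = m + 1) (hNb : ∀ x ∈ N, ∀ y ∈ N, b x y = 0) {x : E}
    (hx : ∀ y ∈ N, b x y = 0) : x ∈ N := by
  have href : b.IsRefl := fun x y h => by rw [hb, h]
  have h1 := LinearMap.BilinForm.finrank_add_finrank_orthogonal href N
  have h2 : finrank k (N ⊓ b.orthogonal ⊤ : Submodule k E) ≤ finrank k (LinearMap.ker b) := by
    refine Submodule.finrank_mono (inf_le_right.trans fun y hy => ?_)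
    rw [LinearMap.mem_ker]
    ext z
    rw [hb]
    exact (LinearMap.BilinForm.mem_orthogonal_iff.1 hy) z trivial
  have hle : N ≤ b.orthogonal N := fun y hy =>
    LinearMap.BilinForm.mem_orthogonal_iff.2 fun z hz => hNb z hz y hy
  -- The complement has dimension at most `(2m + 1) - (m + 1) + 1 = m + 1`, that of `N`.
  rw [Submodule.eq_of_le_of_finrank_le hle (by omega)]
  exact LinearMap.BilinForm.mem_orthogonal_iff.2 fun z hz => by
    change b z x = 0
    rw [hb, hx z hz]

/-- A subspace of maximal dimension that is isotropic for all members of a pencil contains the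
coefficients of the kernel vectors. -/
theorem IsChain.mem_of_isotropic {m : ℕ} {β₀ β₁ : LinearMap.BilinForm k E}
    (h₀ : ∀ x y, β₀ x y = β₀ y x) (hE : finrank k E = 2 * m + 1)
    (hker : finrank k (LinearMap.ker β₀) ≤ 1) {N : Submodule k E}
    (hN : finrank k N = m + 1) (hN₀ : ∀ x ∈ N, ∀ y ∈ N, β₀ x y = 0)
    (hN₁ : ∀ x ∈ N, ∀ y ∈ N, β₁ x y = 0) {w : ℕ → E} (hw : IsChain β₀ β₁ w) (j : ℕ) :
    w j ∈ N := by
  induction j with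
  | zero =>
    exact QuadricPencil.mem_of_isotropic h₀ hE hker hN hN₀ fun y _ => by
      rw [hw.zero, LinearMap.zero_apply]
  | succ j ih =>
    refine QuadricPencil.mem_of_isotropic h₀ hE hker hN hN₀ fun y hy => ?_
    have := LinearMap.congr_fun (hw.succ j) y
    rwa [LinearMap.add_apply, hN₁ _ ih y hy, add_zero, LinearMap.zero_apply] at this

end Chains

/-! ### Zeros of binary forms -/

section Zeros

variable {K : Type*} [Field K] [IsAlgClosed K]

/-- Either the coefficient of `t ^ m` vanishes and `(0, 1)` is a zero, or setting `s = 1` gives a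
polynomial of positive degree. -/
theorem exists_zero_binaryForm {m : ℕ} (hm : 1 ≤ m) (α : ℕ → K) :
    ∃ s t : K, ¬ (s = 0 ∧ t = 0) ∧
      ∑ j ∈ Finset.range (m + 1), (s ^ (m - j) * t ^ j) * α j = 0 := by
  by_cases h : α m = 0
  · refine ⟨0, 1, by simp, Finset.sum_eq_zero fun j hj => ?_⟩
    rw [Finset.mem_range] at hj
    rcases eq_or_ne j m with rfl | hne
    · rw [h, mul_zero]
    · rw [zero_pow (by omega), zero_mul, zero_mul]
  · let p : Polynomial K := ∑ j ∈ Finset.range (m + 1), Polynomial.monomial j (α j)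
    have hp : p.coeff m = α m := by
      simp only [p, Polynomial.finsetSum_coeff, Polynomial.coeff_monomial]
      rw [Finset.sum_ite_eq' _ m, if_pos (Finset.mem_range.2 (by omega))]
    obtain ⟨t, ht⟩ := IsAlgClosed.exists_root p (by
      intro h0
      have := Polynomial.le_degree_of_ne_zero (p := p) (n := m) (by rwa [hp])
      rw [h0] at this
      exact absurd (Nat.cast_le.1 (this.trans_eq Nat.cast_zero.symm)) (by omega))
    refine ⟨1, t, by simp, ?_⟩
    rw [← ht.eq_zero]
    simp [p, Polynomial.eval_finsetSum, mul_comm]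

theorem exists_common_zero_binaryForm {m : ℕ} (hm : 1 ≤ m) (α : Fin 2 → ℕ → K) {c₀ c₁ : K}
    (hc : ¬ (c₀ = 0 ∧ c₁ = 0)) (h : ∀ j ≤ m, c₀ * α 0 j + c₁ * α 1 j = 0) :
    ∃ s t : K, ¬ (s = 0 ∧ t = 0) ∧
      ∀ c, ∑ j ∈ Finset.range (m + 1), (s ^ (m - j) * t ^ j) * α c j = 0 := by
  have hsum : ∀ s t : K,
      c₀ * (∑ j ∈ Finset.range (m + 1), (s ^ (m - j) * t ^ j) * α 0 j) +
      c₁ * (∑ j ∈ Finset.range (m + 1), (s ^ (m - j) * t ^ j) * α 1 j) = 0 := by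
    intro s t
    rw [Finset.mul_sum, Finset.mul_sum, ← Finset.sum_add_distrib]
    refine Finset.sum_eq_zero fun j hj => ?_
    rw [Finset.mem_range] at hj
    linear_combination (s ^ (m - j) * t ^ j) * h j (by omega)
  by_cases hc₀ : c₀ = 0
  · have hc₁ : c₁ ≠ 0 := fun h => hc ⟨hc₀, h⟩
    obtain ⟨s, t, hst, h0⟩ := exists_zero_binaryForm hm (α 0)
    refine ⟨s, t, hst, fun c => ?_⟩
    have := hsum s t
    fin_cases c
    · exact h0
    · simpa [h0, hc₁] using this
  · obtain ⟨s, t, hst, h1⟩ := exists_zero_binaryForm hm (α 1)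
    refine ⟨s, t, hst, fun c => ?_⟩
    have := hsum s t
    fin_cases c
    · simpa [h1, hc₀] using this
    · exact h1

end Zeros

/-- Two independent radical vectors over `k` would stay independent over `K`, where the radical is a
line. -/
theorem finrank_ker_polarBilin_le_one {k E U K : Type*} [Field k] [AddCommGroup E]
    [Module k E] [AddCommGroup U] [Module k U] [Field K] [Algebra k K] [IsAlgClosed K] [CharP K 2]
    {m : ℕ} (q : U →ₗ[k] QuadraticForm k E) (u : Basis (Fin 2) k U)
    (e : Basis (Fin (2 * m + 1)) k E) {B : Fin 2 → LinearMap.BilinForm k E}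
    (hB : ∀ c, LinearMap.BilinMap.toQuadraticMap (B c) = q (u c))
    (hR : IsRegularPair (extForm K (B 0)) (extForm K (B 1))) :
    finrank k (LinearMap.ker (QuadraticMap.polarBilin (q (u 0)))) ≤ 1 := by
  have : FiniteDimensional k E := e.finiteDimensional_of_finite
  have hodd : Odd (finrank K (TensorProduct k K E)) := by
    rw [Module.finrank_baseChange, finrank_eq_card_basis e, Fintype.card_fin]
    exact odd_two_mul_add_one m
  have hker := (hR.finrank_ker hodd (s := 1) (t := 0) (by simp)).le
  rw [one_smul, zero_smul, add_zero] at hker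
  have hmem : ∀ y ∈ LinearMap.ker (QuadraticMap.polarBilin (q (u 0))),
      (1 : K) ⊗ₜ[k] y ∈ LinearMap.ker (QuadraticMap.polarBilin (extForm K (B 0))) := by
    intro y hy
    rw [LinearMap.mem_ker]
    ext z
    have := LinearMap.congr_fun (LinearMap.mem_ker.1 hy) z
    rw [QuadraticMap.polarBilin_apply_apply, LinearMap.zero_apply] at this
    change QuadraticMap.polar (extForm K (B 0)) (1 ⊗ₜ y) (1 ⊗ₜ z) = 0
    rw [polar_extForm_tmul, hB, this, map_zero, zero_mul]
  by_contra! h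
  obtain ⟨⟨x, hx⟩, hx0⟩ := (finrank_pos_iff_exists_ne_zero (R := k)
    (M := LinearMap.ker (QuadraticMap.polarBilin (q (u 0))))).1 (by omega)
  obtain ⟨⟨y, hy⟩, hxy⟩ := exists_linearIndependent_pair_of_one_lt_finrank h hx0
  obtain ⟨i, hi⟩ : ∃ i, e.repr x i ≠ 0 := by
    by_contra! h
    exact hx0 (Subtype.ext (e.repr.map_eq_zero_iff.1 (Finsupp.ext h)))
  have hrepr : ∀ z i, (e.baseChange K).repr (1 ⊗ₜ z) i = algebraMap k K (e.repr z i) := fun z i => by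
    rw [Basis.baseChange_repr_tmul, Algebra.smul_def, mul_one]
  have hx1 : (1 : K) ⊗ₜ[k] x ≠ 0 := fun h => hi ((algebraMap k K).injective (by
    rw [← hrepr, h, map_zero, map_zero, Finsupp.zero_apply]))
  obtain ⟨c, hc⟩ := exists_eq_smul_of_finrank_le_one hker (hmem x hx) (hmem y hy) hx1
  have hc' : ∀ j, algebraMap k K (e.repr y j) = c * algebraMap k K (e.repr x j) := fun j => by
    rw [← hrepr, hc, map_smul, Finsupp.smul_apply, hrepr, smul_eq_mul]
  have h0 : e.repr y i • x - e.repr x i • y = 0 := by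
    refine e.repr.map_eq_zero_iff.1 (Finsupp.ext fun j => (algebraMap k K).injective ?_)
    simp only [map_sub, map_smul, Finsupp.sub_apply, Finsupp.smul_apply, smul_eq_mul, map_mul, hc',
      Finsupp.zero_apply, map_zero]
    ring
  have := LinearIndependent.pair_iff.1 hxy (e.repr y i) (-e.repr x i) (by
    ext
    simpa [sub_eq_add_neg] using h0)
  exact hi (neg_eq_zero.1 this.2)

/-! ### The radical subspace of a regular pencil -/

section Radical

variable {k E U : Type*} [Field k] [AddCommGroup E] [Module k E] [AddCommGroup U] [Module k U]
  {m : ℕ}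

theorem radicalSeq_eq_zero {n : ℕ} (q : U →ₗ[k] QuadraticForm k E) (u : Basis (Fin 2) k U)
    (e : Basis (Fin n) k E) {j : ℕ} (hj : m < j) : radicalSeq m q u e j = 0 :=
  if_neg (by omega)

variable (q : U →ₗ[k] QuadraticForm k E) (u : Basis (Fin 2) k U)
  (e : Basis (Fin (2 * m + 1)) k E)

theorem radicalSeq_mem {j : ℕ} (hj : j ≤ m) : radicalSeq m q u e j ∈ radicalSubspace q u e := by
  rw [radicalSubspace_eq_span]
  exact Submodule.subset_span ⟨⟨j, by omega⟩, rfl⟩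

variable [CharP k 2]

theorem polar_radicalSubspace (a : U) {x y : E} (hx : x ∈ radicalSubspace q u e)
    (hy : y ∈ radicalSubspace q u e) : QuadraticMap.polar (q a) x y = 0 := by
  rw [radicalSubspace_eq_span] at hx hy
  have hiso := (isChain_radicalSeq q u e).isotropic
    (fun x y => QuadraticMap.polar_comm _ x y) (fun x y => QuadraticMap.polar_comm _ x y)
  have h₀ := isotropic_span (β := QuadraticMap.polarBilin (q (u 0)))
    (fun i j : Fin (m + 1) => (hiso i j).1) hx hy
  have h₁ := isotropic_span (β := QuadraticMap.polarBilin (q (u 1)))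
    (fun i j : Fin (m + 1) => (hiso i j).2) hx hy
  rw [QuadraticMap.polarBilin_apply_apply] at h₀ h₁
  rw [← u.sum_repr a, Fin.sum_univ_two, map_add, map_smul, map_smul, polar_comb, h₀, h₁]
  simp

variable {K : Type*} [Field K] [Algebra k K] [IsAlgClosed K] [CharP K 2]

/-- The half-discriminant of a regular pencil and the restriction of the forms of the pencil to the
radical curve have no common zero. -/
theorem IsRegularPair.not_common_zero {B : Fin 2 → LinearMap.BilinForm k E}
    (hB : ∀ c, LinearMap.BilinMap.toQuadraticMap (B c) = q (u c))
    (hR : IsRegularPair (extForm K (B 0)) (extForm K (B 1))) {s t : K}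
    (hst : ¬ (s = 0 ∧ t = 0)) :
    ¬ ∀ c, ∑ j ∈ Finset.range (m + 1),
      (s ^ (m - j) * t ^ j) ^ 2 * algebraMap k K (q (u c) (radicalSeq m q u e j)) = 0 := by
  intro h
  have hx := sum_radicalSeq_ne_zero q u e B hB hR hst
  have hchain := isChain_tmul (K := K) (hB 0) (hB 1) (isChain_radicalSeq q u e)
  have hker := hchain.sum_mem_ker (m := m)
    (fun j hj => by rw [radicalSeq_eq_zero q u e hj, TensorProduct.tmul_zero]) s t
  -- The coefficients of `Ω` are mutually orthogonal, so each form is additive on them, and `Ω(s,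
  -- t)` is a base point lying in the radical of the member `(s, t)`.
  have hval : ∀ c, extForm K (B c) (∑ j ∈ Finset.range (m + 1),
      (s ^ (m - j) * t ^ j) • ((1 : K) ⊗ₜ[k] radicalSeq m q u e j)) = 0 := by
    intro c
    rw [map_sum_of_isotropic, ← h c]
    · refine Finset.sum_congr rfl fun j _ => ?_
      rw [QuadraticMap.map_smul, extForm_tmul, ← hB, LinearMap.BilinMap.toQuadraticMap_apply,
        one_pow, mul_one, smul_eq_mul, sq]
    · intro i j
      rw [QuadraticMap.polar_smul_left, QuadraticMap.polar_smul_right, polar_extForm_tmul, hB]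
      have hmem : ∀ j, radicalSeq m q u e j ∈ radicalSubspace q u e := fun j => by
        by_cases hj : j ≤ m
        · exact radicalSeq_mem q u e hj
        · rw [radicalSeq_eq_zero q u e (by omega)]
          exact Submodule.zero_mem _
      rw [polar_radicalSubspace q u e (u c) (hmem i) (hmem j)]
      simp
  exact hst (hR _ hx (hval 0) (hval 1) s t fun y => LinearMap.congr_fun hker y)

theorem linearIndependent_radicalSeq {B : Fin 2 → LinearMap.BilinForm k E}
    (hB : ∀ c, LinearMap.BilinMap.toQuadraticMap (B c) = q (u c))
    (hR : IsRegularPair (extForm K (B 0)) (extForm K (B 1))) :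
    LinearIndependent k fun j : Fin (m + 1) => radicalSeq m q u e j := by
  have : FiniteDimensional k E := e.finiteDimensional_of_finite
  have hchain := isChain_tmul (K := K) (hB 0) (hB 1) (isChain_radicalSeq q u e)
  have hne := fun s t => sum_radicalSeq_ne_zero q u e B hB hR (s := s) (t := t)
  have hodd : Odd (finrank K (TensorProduct k K E)) := by
    rw [Module.finrank_baseChange, finrank_eq_card_basis e, Fintype.card_fin]
    exact odd_two_mul_add_one m
  have hli := hchain.linearIndependent (m := m)
    (fun j hj => by rw [radicalSeq_eq_zero q u e hj, TensorProduct.tmul_zero])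
    (fun t => by
      have := (hR.finrank_ker hodd (s := 1) (t := t) (by simp)).le
      rwa [one_smul] at this)
    (fun t => by simpa using hne 1 t (by simp))
    -- The value of `Ω` at `(0, 1)` is its last coefficient.
    (by
      have := hne 0 1 (by simp)
      rw [Finset.sum_range_succ, Finset.sum_eq_zero] at this
      · simpa using this
      · intro j hj
        rw [Finset.mem_range] at hj
        rw [zero_pow (by omega), zero_mul, zero_smul])
  rw [Fintype.linearIndependent_iff] at hli ⊢
  intro g hg i
  refine (algebraMap k K).injective ?_
  rw [map_zero]
  refine hli (fun j => algebraMap k K (g j)) ?_ i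
  calc ∑ j, algebraMap k K (g j) • (1 : K) ⊗ₜ[k] radicalSeq m q u e j
      = (1 : K) ⊗ₜ[k] ∑ j, g j • radicalSeq m q u e j := by
        rw [TensorProduct.tmul_sum]
        exact Finset.sum_congr rfl fun j _ => by rw [algebraMap_smul, TensorProduct.tmul_smul]
    _ = 0 := by rw [hg, TensorProduct.tmul_zero]

end Radical

/-! ### The zero locus on the radical subspace -/

section Plane

variable {k E U : Type*} [Field k] [AddCommGroup E] [Module k E]
  [AddCommGroup U] [Module k U]

/-- The zero locus of a quadratic pencil in a subspace that is isotropic for the polar forms. -/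
def zeroLocus (q : U →ₗ[k] QuadraticForm k E) (W : Submodule k E)
    (hW : ∀ a, ∀ x ∈ W, ∀ y ∈ W, QuadraticMap.polar (q a) x y = 0) : Submodule k E where
  carrier := {x | x ∈ W ∧ ∀ a, q a x = 0}
  zero_mem' := ⟨W.zero_mem, fun a => QuadraticMap.map_zero _⟩
  add_mem' := fun hx hy => ⟨W.add_mem hx.1 hy.1, fun a => by
    rw [QuadraticMap.map_add (q a), hx.2, hy.2, hW a _ hx.1 _ hy.1, add_zero, add_zero]⟩
  smul_mem' := fun c x hx => ⟨W.smul_mem c hx.1, fun a => by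
    rw [QuadraticMap.map_smul, hx.2, smul_zero]⟩

theorem forall_eq_zero_iff (q : U →ₗ[k] QuadraticForm k E) (u : Basis (Fin 2) k U) (x : E) :
    (∀ a, q a x = 0) ↔ ∀ c, q (u c) x = 0 := by
  refine ⟨fun h c => h _, fun h a => ?_⟩
  rw [← u.sum_repr a, Fin.sum_univ_two, map_add, map_smul, map_smul, add_apply, smul_apply,
    smul_apply, h, h, smul_zero, smul_zero, add_zero]

theorem finrank_inf_ker_of_independent {V : Type*} [AddCommGroup V] [Module k V]
    [FiniteDimensional k V] (l₀ l₁ : Dual k V)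
    (h : ∀ c₀ c₁ : k, c₀ • l₀ + c₁ • l₁ = 0 → c₀ = 0 ∧ c₁ = 0) :
    finrank k (LinearMap.ker l₀ ⊓ LinearMap.ker l₁ : Submodule k V) + 2 = finrank k V := by
  have hl₀ : l₀ ≠ 0 := fun h0 => by simpa using h 1 0 (by simp [h0])
  have h1 := Module.Dual.finrank_ker_add_one_of_ne_zero hl₀
  have hres : l₁.domRestrict (LinearMap.ker l₀) ≠ 0 := by
    intro h0
    obtain ⟨c, hc⟩ := exists_smul_eq_of_ker_le_ker (f := l₀) (g := l₁) fun x hx =>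
      LinearMap.congr_fun h0 ⟨x, hx⟩
    simpa using (h c (-1) (by rw [hc]; ext x; simp)).2
  have h2 := Module.Dual.finrank_ker_add_one_of_ne_zero hres
  have h3 : finrank k (LinearMap.ker (l₁.domRestrict (LinearMap.ker l₀)))
      = finrank k (LinearMap.ker l₀ ⊓ LinearMap.ker l₁ : Submodule k V) := by
    rw [← Submodule.map_comap_subtype]
    exact (Submodule.finrank_map_subtype_eq _ _).symm
  omega

variable [CharP k 2] [PerfectField k]

/-- Over a perfect field of characteristic two, a quadratic form whose polar form vanishes on a
subspace is the square of a linear form on this subspace. -/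
theorem exists_sq_eq (Q : QuadraticForm k E) (W : Submodule k E)
    (hW : ∀ x ∈ W, ∀ y ∈ W, QuadraticMap.polar Q x y = 0) :
    ∃ l : Dual k W, ∀ x : W, l x ^ 2 = Q x := by
  have hroot : ∀ a : k, (frobeniusEquiv k 2).symm a ^ 2 = a := fun a =>
    frobeniusEquiv_symm_pow_p k 2 a
  -- On `W` the form is additive and Frobenius-semilinear, so its square root is linear.
  refine ⟨{ toFun := fun x => (frobeniusEquiv k 2).symm (Q x), map_add' := ?_, map_smul' := ?_ },
    fun x => hroot _⟩
  · intro x y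
    rw [← map_add, Submodule.coe_add, QuadraticMap.map_add Q, hW x x.2 y y.2, add_zero]
  · intro c x
    rw [Submodule.coe_smul, QuadraticMap.map_smul, RingHom.id_apply]
    refine frobenius_inj k 2 ?_
    simp only [frobenius_def, smul_eq_mul, mul_pow, hroot]
    ring

variable {m : ℕ} (q : U →ₗ[k] QuadraticForm k E) (u : Basis (Fin 2) k U)
  (e : Basis (Fin (2 * m + 1)) k E)

/-- The two square roots `l 0`, `l 1` are independent on `W`: otherwise their values on `Ω` are
linearly dependent binary forms, whose common zero contradicts `IsRegularPair.not_common_zero`. -/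
theorem finrank_zeroLocus {K : Type*} [Field K] [Algebra k K] [IsAlgClosed K] [CharP K 2]
    (hm : 1 ≤ m) {B : Fin 2 → LinearMap.BilinForm k E}
    (hB : ∀ c, LinearMap.BilinMap.toQuadraticMap (B c) = q (u c))
    (hR : IsRegularPair (extForm K (B 0)) (extForm K (B 1))) :
    finrank k (zeroLocus q (radicalSubspace q u e)
      fun a _ hx _ hy => polar_radicalSubspace q u e a hx hy) + 2
      = finrank k (radicalSubspace q u e) := by
  have : FiniteDimensional k E := e.finiteDimensional_of_finite
  set W := radicalSubspace q u e
  have hW : ∀ a, ∀ x ∈ W, ∀ y ∈ W, QuadraticMap.polar (q a) x y = 0 :=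
    fun a x hx y hy => polar_radicalSubspace q u e a hx hy
  choose l hl using fun c => exists_sq_eq (q (u c)) W (hW (u c))
  have hzero : zeroLocus q W hW = (LinearMap.ker (l 0) ⊓ LinearMap.ker (l 1)).map W.subtype := by
    ext x
    rw [Submodule.mem_map]
    constructor
    · rintro ⟨hx, hx0⟩
      refine ⟨⟨x, hx⟩, ⟨?_, ?_⟩, rfl⟩
      · exact pow_eq_zero_iff two_ne_zero |>.1 ((hl 0 ⟨x, hx⟩).trans (hx0 _))
      · exact pow_eq_zero_iff two_ne_zero |>.1 ((hl 1 ⟨x, hx⟩).trans (hx0 _))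
    · rintro ⟨y, ⟨h0, h1⟩, rfl⟩
      refine ⟨y.2, (forall_eq_zero_iff q u _).2 fun c => ?_⟩
      change q (u c) y = 0
      rw [← hl c y]
      fin_cases c
      · exact (pow_eq_zero_iff two_ne_zero).2 h0
      · exact (pow_eq_zero_iff two_ne_zero).2 h1
  rw [hzero, Submodule.finrank_map_subtype_eq]
  refine finrank_inf_ker_of_independent (l 0) (l 1) fun c₀ c₁ hc => ?_
  by_contra hne
  let w : ℕ → W := fun j => if h : j ≤ m then ⟨radicalSeq m q u e j, radicalSeq_mem q u e h⟩ else 0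
  obtain ⟨s, t, hst, hz⟩ := exists_common_zero_binaryForm hm
    (fun c j => algebraMap k K (l c (w j))) (c₀ := algebraMap k K c₀) (c₁ := algebraMap k K c₁)
    (by simpa using hne) (fun j _ => by
      rw [← map_mul, ← map_mul, ← map_add]
      have := LinearMap.congr_fun hc (w j)
      rw [LinearMap.add_apply, LinearMap.smul_apply, LinearMap.smul_apply, smul_eq_mul,
        smul_eq_mul, LinearMap.zero_apply] at this
      rw [this, map_zero])
  refine hR.not_common_zero q u e hB hst fun c => ?_
  -- Squaring the zero of `l c` on `Ω` term by term gives the zero of `q (u c)`.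
  rw [← (pow_eq_zero_iff two_ne_zero).2 (hz c), CharTwo.sum_sq]
  refine Finset.sum_congr rfl fun j hj => ?_
  rw [Finset.mem_range] at hj
  rw [mul_pow _ (algebraMap k K _), ← map_pow, hl, show w j = ⟨radicalSeq m q u e j, radicalSeq_mem q u e (by omega)⟩
    from dif_pos (by omega)]

end Plane

/-! ### Dimension and independence of the bases -/

section Canonical

variable {k E U : Type*} [Field k] [CharP k 2] [AddCommGroup E] [Module k E]
  [AddCommGroup U] [Module k U] {m : ℕ} {q : U →ₗ[k] QuadraticForm k E}

theorem exists_bilinForm_isRegularPair (hm : 2 ≤ m) (hE : finrank k E = 2 * m + 1)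
    (hq : Function.Injective q) (hreg : IsRegular q) (u : Basis (Fin 2) k U) :
    ∃ B : Fin 2 → LinearMap.BilinForm k E,
      (∀ c, LinearMap.BilinMap.toQuadraticMap (B c) = q (u c)) ∧
      IsRegularPair (extForm (AlgebraicClosure k) (B 0)) (extForm (AlgebraicClosure k) (B 1)) := by
  have : FiniteDimensional k E := FiniteDimensional.of_finrank_pos (by omega)
  have : CharP (AlgebraicClosure k) 2 :=
    charP_of_injective_algebraMap (algebraMap k (AlgebraicClosure k)).injective 2
  choose B hB using fun c => LinearMap.BilinMap.toQuadraticMap_surjective (q (u c))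
  exact ⟨B, hB, isRegularPair_extForm q hq hreg (by omega) u B hB⟩

theorem finrank_radicalSubspace (hm : 2 ≤ m) (hE : finrank k E = 2 * m + 1)
    (hq : Function.Injective q) (hreg : IsRegular q) (u : Basis (Fin 2) k U)
    (e : Basis (Fin (2 * m + 1)) k E) : finrank k (radicalSubspace q u e) = m + 1 := by
  have : CharP (AlgebraicClosure k) 2 :=
    charP_of_injective_algebraMap (algebraMap k (AlgebraicClosure k)).injective 2
  obtain ⟨B, hB, hR⟩ := exists_bilinForm_isRegularPair hm hE hq hreg u
  rw [radicalSubspace_eq_span, finrank_span_eq_card (linearIndependent_radicalSeq q u e hB hR),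
    Fintype.card_fin]

/-- The radical subspace of a regular pencil does not depend on the choice of the bases. -/
theorem radicalSubspace_eq (hm : 2 ≤ m) (hE : finrank k E = 2 * m + 1)
    (hq : Function.Injective q) (hreg : IsRegular q) (u u' : Basis (Fin 2) k U)
    (e e' : Basis (Fin (2 * m + 1)) k E) : radicalSubspace q u e = radicalSubspace q u' e' := by
  have : FiniteDimensional k E := e.finiteDimensional_of_finite
  have : CharP (AlgebraicClosure k) 2 :=
    charP_of_injective_algebraMap (algebraMap k (AlgebraicClosure k)).injective 2
  have hrank := finrank_radicalSubspace hm hE hq hreg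
  refine Submodule.eq_of_le_of_finrank_le ?_ (by rw [hrank, hrank])
  obtain ⟨B, hB, hR⟩ := exists_bilinForm_isRegularPair hm hE hq hreg u
  rw [radicalSubspace_eq_span q u e, Submodule.span_le]
  rintro _ ⟨j, rfl⟩
  -- The other radical subspace is isotropic for the whole pencil and of maximal dimension, so it
  -- absorbs this chain.
  exact (isChain_radicalSeq q u e).mem_of_isotropic (fun x y => QuadraticMap.polar_comm _ x y) hE
    (finrank_ker_polarBilin_le_one q u e hB hR) (hrank u' e')
    (fun x hx y hy => polar_radicalSubspace q u' e' _ hx hy)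
    (fun x hx y hy => polar_radicalSubspace q u' e' _ hx hy) j

end Canonical

/-! ### Ideals of linear subspaces and the reduced intersection -/

section Ideals

variable {k E U : Type*} [Field k] [AddCommGroup E] [Module k E] [AddCommGroup U] [Module k U]
variable {n : ℕ}

/-- The linear form `φ` as a polynomial in the coordinates. -/
def linearPoly (e : Basis (Fin n) k E) : Dual k E →ₗ[k] MvPolynomial (Fin n) k where
  toFun φ := ∑ i, MvPolynomial.C (φ (e i)) * MvPolynomial.X i
  map_add' φ ψ := by simp [add_mul, Finset.sum_add_distrib]
  map_smul' c φ := by simp [MvPolynomial.smul_eq_C_mul, Finset.mul_sum, mul_assoc]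

theorem linearPoly_apply (e : Basis (Fin n) k E) (φ : Dual k E) :
    linearPoly e φ = ∑ i, MvPolynomial.C (φ (e i)) * MvPolynomial.X i := rfl

theorem linearPoly_coord (e : Basis (Fin n) k E) (i : Fin n) :
    linearPoly e (e.coord i) = MvPolynomial.X i := by
  rw [linearPoly_apply, Finset.sum_eq_single i]
  · simp
  · intro j _ hj
    simp [hj]
  · simp

theorem linearPoly_mem {e : Basis (Fin n) k E} {P : Submodule k E} {φ : Dual k E}
    (hφ : ∀ x ∈ P, φ x = 0) : linearPoly e φ ∈ linearIdeal e P :=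
  Ideal.subset_span ⟨φ, hφ, rfl⟩

theorem linearIdeal_anti (e : Basis (Fin n) k E) {P W : Submodule k E} (h : P ≤ W) :
    linearIdeal e W ≤ linearIdeal e P :=
  Ideal.span_mono fun _ ⟨φ, hφ, hf⟩ => ⟨φ, fun x hx => hφ x (h hx), hf⟩

/-- The linear substitution of the coordinates that corresponds to an endomorphism of `E`. -/
def linearSubst (e : Basis (Fin n) k E) (π : E →ₗ[k] E) :
    MvPolynomial (Fin n) k →ₐ[k] MvPolynomial (Fin n) k :=
  MvPolynomial.aeval fun i => linearPoly e (e.coord i ∘ₗ π)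

theorem linearSubst_linearPoly (e : Basis (Fin n) k E) (π : E →ₗ[k] E) (φ : Dual k E) :
    linearSubst e π (linearPoly e φ) = linearPoly e (φ ∘ₗ π) := by
  have h : φ = ∑ i, φ (e i) • e.coord i := by
    refine e.ext fun j => ?_
    rw [LinearMap.sum_apply, Finset.sum_eq_single j]
    · simp
    · intro i _ hi
      simp [hi.symm]
    · simp
  have hX : ∀ i, linearSubst e π (linearPoly e (e.coord i)) = linearPoly e (e.coord i ∘ₗ π) :=
    fun i => by rw [linearPoly_coord, linearSubst, MvPolynomial.aeval_X]
  have hc : φ ∘ₗ π = ∑ i, φ (e i) • (e.coord i ∘ₗ π) := by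
    ext x
    rw [LinearMap.comp_apply, LinearMap.congr_fun h (π x), LinearMap.sum_apply,
      LinearMap.sum_apply]
    rfl
  rw [hc]
  conv_lhs => rw [h]
  rw [map_sum, map_sum, map_sum]
  exact Finset.sum_congr rfl fun i _ => by rw [map_smul, map_smul, hX, map_smul]

/-- The ideal of a linear subspace is the kernel of the substitution by a projection to it. -/
theorem linearIdeal_eq_ker (e : Basis (Fin n) k E) {P : Submodule k E} {π : E →ₗ[k] E}
    (hπ : ∀ x ∈ P, π x = x) (hπP : ∀ x, π x ∈ P) :
    linearIdeal e P = RingHom.ker (linearSubst e π) := by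
  apply le_antisymm
  · rw [linearIdeal, Ideal.span_le]
    rintro _ ⟨φ, hφ, rfl⟩
    change linearSubst e π (linearPoly e φ) = 0
    rw [linearSubst_linearPoly, show φ ∘ₗ π = 0 from LinearMap.ext fun x => hφ _ (hπP x), map_zero]
  · intro f hf
    -- Modulo the linear forms vanishing on `P`, the substitution by the projection is the identity.
    have hmod : ∀ f, Ideal.Quotient.mkₐ k (linearIdeal e P) (linearSubst e π f)
        = Ideal.Quotient.mkₐ k (linearIdeal e P) f := by
      intro f
      refine DFunLike.congr_fun (show (Ideal.Quotient.mkₐ k (linearIdeal e P)).comp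
        (linearSubst e π) = Ideal.Quotient.mkₐ k (linearIdeal e P) from
          MvPolynomial.algHom_ext fun i => ?_) f
      change Ideal.Quotient.mk (linearIdeal e P) (linearSubst e π (MvPolynomial.X i)) =
        Ideal.Quotient.mk (linearIdeal e P) (MvPolynomial.X i)
      rw [Ideal.Quotient.eq, ← linearPoly_coord e, linearSubst_linearPoly, ← map_sub]
      exact linearPoly_mem fun x hx => by
        rw [LinearMap.sub_apply, LinearMap.comp_apply, hπ x hx, sub_self]
    have := hmod f
    rw [show linearSubst e π f = 0 from hf, map_zero] at this
    exact Ideal.Quotient.eq_zero_iff_mem.1 this.symm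

theorem exists_projection (P : Submodule k E) :
    ∃ π : E →ₗ[k] E, (∀ x ∈ P, π x = x) ∧ ∀ x, π x ∈ P := by
  obtain ⟨f, hf⟩ := P.subtype.exists_leftInverse_of_injective P.ker_subtype
  exact ⟨P.subtype ∘ₗ f, fun x hx => congrArg Subtype.val (LinearMap.congr_fun hf ⟨x, hx⟩),
    fun x => (f x).2⟩

theorem linearIdeal_isPrime (e : Basis (Fin n) k E) (P : Submodule k E) :
    (linearIdeal e P).IsPrime := by
  obtain ⟨π, h1, h2⟩ := exists_projection P
  rw [linearIdeal_eq_ker e h1 h2]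
  exact RingHom.ker_isPrime _

/-- A quadratic form that vanishes on a subspace lies in the ideal of the subspace. -/
theorem quadraticPoly_mem_linearIdeal (e : Basis (Fin n) k E) {P : Submodule k E}
    {Q : QuadraticForm k E} (hQ : ∀ x ∈ P, Q x = 0) : quadraticPoly e Q ∈ linearIdeal e P := by
  obtain ⟨π, h1, h2⟩ := exists_projection P
  have : Module.Free k E := Module.Free.of_basis e
  obtain ⟨B, rfl⟩ := LinearMap.BilinMap.toQuadraticMap_surjective Q
  rw [linearIdeal_eq_ker e h1 h2, RingHom.mem_ker]
  have h0 : LinearMap.BilinMap.toQuadraticMap (LinearMap.BilinForm.comp B π π) = 0 := by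
    ext x
    exact hQ _ (h2 x)
  have hsum : linearSubst e π (quadraticPoly e (LinearMap.BilinMap.toQuadraticMap B))
      = quadraticPoly e (LinearMap.BilinMap.toQuadraticMap (LinearMap.BilinForm.comp B π π)) := by
    set p : Fin n → MvPolynomial (Fin n) k := fun i => linearPoly e (e.coord i ∘ₗ π) with hp
    have hlin : ∀ ψ : Dual k E, ∑ i, MvPolynomial.C (ψ (e i)) * p i
        = ∑ i, MvPolynomial.C (ψ (π (e i))) * MvPolynomial.X i := by
      intro ψ
      have h := linearSubst_linearPoly e π ψ
      rw [linearPoly_apply, linearPoly_apply, linearSubst, map_sum] at h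
      simpa [map_mul] using h
    rw [linearSubst, aeval_quadraticPoly, quadraticPoly_toQuadraticMap]
    calc ∑ i, ∑ j, MvPolynomial.C (B (e i) (e j)) * (p i * p j)
        = ∑ j, (∑ i, MvPolynomial.C (B.flip (e j) (e i)) * p i) * p j := by
          rw [Finset.sum_comm]
          simp only [Finset.sum_mul, mul_assoc, LinearMap.flip_apply]
      _ = ∑ i, (∑ j, MvPolynomial.C (B (π (e i)) (e j)) * p j) * MvPolynomial.X i := by
          rw [Finset.sum_congr rfl fun j _ => congrArg (· * p j) (hlin (B.flip (e j)))]
          simp only [Finset.sum_mul, LinearMap.flip_apply]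
          rw [Finset.sum_comm]
          exact Finset.sum_congr rfl fun i _ => Finset.sum_congr rfl fun j _ => by ring
      _ = ∑ i, ∑ j, MvPolynomial.C (B (π (e i)) (π (e j))) *
            (MvPolynomial.X i * MvPolynomial.X j) := by
          rw [Finset.sum_congr rfl fun i _ => congrArg (· * MvPolynomial.X i) (hlin (B (π (e i))))]
          simp only [Finset.sum_mul]
          exact Finset.sum_congr rfl fun i _ => Finset.sum_congr rfl fun j _ => by ring
  rw [hsum, h0, ← zero_smul k (0 : QuadraticForm k E), quadraticPoly_smul, map_zero, zero_mul]

/-- A point of `P'` outside `P` is separated from `P` by a linear form. This recovers a subspace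
from its ideal and yields uniqueness. -/
theorem mem_of_linearIdeal_le (e : Basis (Fin n) k E) {P P' : Submodule k E}
    (h : linearIdeal e P ≤ linearIdeal e P') : P' ≤ P := by
  intro x hx
  by_contra hxP
  obtain ⟨φ, hφx, hφP⟩ := Submodule.exists_le_ker_of_notMem hxP
  have hev : ∀ φ : Dual k E, MvPolynomial.aeval (fun i => e.repr x i) (linearPoly e φ) = φ x := by
    intro φ
    conv_rhs => rw [← e.sum_repr x, map_sum]
    simp [linearPoly_apply, map_sum, mul_comm]
  have hle : linearIdeal e P' ≤ RingHom.ker (MvPolynomial.aeval (R := k) fun i => e.repr x i) := by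
    rw [linearIdeal, Ideal.span_le]
    rintro _ ⟨ψ, hψ, rfl⟩
    exact (hev ψ).trans (hψ x hx)
  have := hle (h (linearPoly_mem (e := e) (φ := φ) fun y hy => hφP hy))
  rw [RingHom.mem_ker, hev] at this
  exact hφx this

theorem quadraticPoly_linMulLin (e : Basis (Fin n) k E) (L : Dual k E) :
    quadraticPoly e (QuadraticMap.linMulLin L L) = linearPoly e L ^ 2 := by
  have : QuadraticMap.linMulLin L L
      = LinearMap.BilinMap.toQuadraticMap ((LinearMap.mul k k).compl₁₂ L L) := by
    ext x; simp
  rw [this, quadraticPoly_toQuadraticMap, sq, linearPoly_apply, Finset.sum_mul_sum]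
  refine Finset.sum_congr rfl fun i _ => Finset.sum_congr rfl fun j _ => ?_
  simp
  ring

/-- The base scheme of a pencil meets a subspace that is isotropic for the polar forms in a linear
subspace, up to its scheme structure. -/
theorem radical_linearIdeal_sup_baseLocusIdeal [CharP k 2] [PerfectField k]
    (q : U →ₗ[k] QuadraticForm k E) (u : Basis (Fin 2) k U) (e : Basis (Fin n) k E)
    (W : Submodule k E) (hW : ∀ a, ∀ x ∈ W, ∀ y ∈ W, QuadraticMap.polar (q a) x y = 0) :
    (linearIdeal e W ⊔ baseLocusIdeal q e).radical = linearIdeal e (zeroLocus q W hW) := by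
  set P := zeroLocus q W hW with hP
  have hPW : P ≤ W := fun x hx => hx.1
  apply le_antisymm
  · have := linearIdeal_isPrime e P
    rw [← this.radical]
    refine Ideal.radical_mono (sup_le (linearIdeal_anti e hPW) ?_)
    rw [baseLocusIdeal, Ideal.span_le]
    rintro _ ⟨a, rfl⟩
    exact quadraticPoly_mem_linearIdeal e fun x hx => hx.2 a
  · rw [linearIdeal, Ideal.span_le]
    rintro _ ⟨φ, hφ, rfl⟩
    change linearPoly e φ ∈ _
    choose l hl using fun c => exists_sq_eq (q (u c)) W (hW (u c))
    -- `φ` vanishes on the common kernel of the `l c`, so on `W` it is a combination of them.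
    have hspan : φ.domRestrict W ∈ Submodule.span k (Set.range l) := by
      refine mem_span_of_iInf_ker_le_ker fun x hx => ?_
      rw [Submodule.mem_iInf] at hx
      refine hφ x ⟨x.2, (forall_eq_zero_iff q u _).2 fun c => ?_⟩
      rw [← hl, LinearMap.mem_ker.1 (hx c), sq, mul_zero]
    obtain ⟨c, hc⟩ := (Submodule.mem_span_range_iff_exists_fun k).1 hspan
    choose L hL using fun i => LinearMap.exists_extend (l i)
    have hLW : ∀ i (x : E) (hx : x ∈ W), L i x = l i ⟨x, hx⟩ := fun i x hx =>
      LinearMap.congr_fun (hL i) ⟨x, hx⟩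
    have h1 : linearPoly e (φ - ∑ i, c i • L i) ∈ linearIdeal e W := linearPoly_mem fun x hx => by
      have := LinearMap.congr_fun hc ⟨x, hx⟩
      rw [LinearMap.sum_apply] at this
      rw [LinearMap.sub_apply, LinearMap.sum_apply, sub_eq_zero]
      refine this.symm.trans (Finset.sum_congr rfl fun i _ => ?_)
      rw [LinearMap.smul_apply, LinearMap.smul_apply, hLW i x hx]
    have h2 : ∀ i, linearPoly e (L i) ∈ (linearIdeal e W ⊔ baseLocusIdeal q e).radical := by
      intro i
      refine ⟨2, ?_⟩
      -- `L i ^ 2` and `q (u i)` agree on `W`, so in characteristic two their sum vanishes there.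
      -- Hence `L i ^ 2` lies in the ideal of the intersection.
      have h3 : quadraticPoly e (QuadraticMap.linMulLin (L i) (L i) + q (u i)) ∈ linearIdeal e W :=
        quadraticPoly_mem_linearIdeal e fun x hx => by
          rw [add_apply, QuadraticMap.linMulLin_apply, hLW i x hx, ← sq, hl,
            CharTwo.add_self_eq_zero]
      rw [quadraticPoly_add, quadraticPoly_linMulLin] at h3
      have h4 : quadraticPoly e (q (u i)) ∈ baseLocusIdeal q e := Ideal.subset_span ⟨_, rfl⟩
      have := Ideal.sub_mem _ (Ideal.mem_sup_left (T := baseLocusIdeal q e) h3)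
        (Ideal.mem_sup_right (S := linearIdeal e W) h4)
      rwa [add_sub_cancel_right] at this
    have h5 : linearPoly e φ = linearPoly e (φ - ∑ i, c i • L i) + ∑ i, c i • linearPoly e (L i) := by
      rw [map_sub, map_sum]
      simp only [map_smul, sub_add_cancel]
    rw [h5]
    refine Ideal.add_mem _ (Ideal.le_radical (Ideal.mem_sup_left h1)) (Ideal.sum_mem _ fun i _ => ?_)
    rw [MvPolynomial.smul_eq_C_mul]
    exact Ideal.mul_mem_left _ _ (h2 i)

end Ideals

/-! ### Automorphisms of the pencil -/

section Automorphisms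

variable {k E U : Type*} [Field k] [AddCommGroup E] [Module k E] [AddCommGroup U] [Module k U]
variable {n : ℕ} {q : U →ₗ[k] QuadraticForm k E}

/-- Moving both bases by the automorphism leaves the polar matrix unchanged, hence also the
Pfaffians; only the basis vectors of `E` move. -/
theorem radicalSubspace_map {g : E ≃ₗ[k] E} {h : U ≃ₗ[k] U}
    (hgh : ∀ a x, q (h a) (g x) = q a x) (u : Basis (Fin 2) k U) (e : Basis (Fin n) k E) :
    radicalSubspace q (u.map h) (e.map g) = (radicalSubspace q u e).map (g : E →ₗ[k] E) := by
  have hpol : polarMatrix q (u.map h) (e.map g) = polarMatrix q u e := by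
    ext i j : 2
    simp only [polarMatrix, Basis.map_apply, QuadraticMap.polar, ← map_add, hgh]
  have hrad : radicalMap q (u.map h) (e.map g) = radicalMap q u e := by
    ext i : 1
    rw [radicalMap, radicalMap, hpol]
  rw [radicalSubspace, radicalSubspace, Submodule.map_span, ← Set.range_comp, hrad]
  congr 2
  ext d
  simp [map_sum]

end Automorphisms

end QuadricPencil

end

/-! ### The canonical plane -/

theorem mainTheorem6 {k E U : Type*} [Field k] [CharP k 2] [PerfectField k]
    [AddCommGroup E] [Module k E] [AddCommGroup U] [Module k U]
    (m : ℕ) (hm : 2 ≤ m)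
    (hE : Module.finrank k E = 2 * m + 1) (hU : Module.finrank k U = 2)
    (q : U →ₗ[k] QuadraticForm k E) (hq : Function.Injective q)
    (hreg : QuadricPencil.IsRegular q) :
    -- the canonical plane, with vector space `P` of dimension `(m - 2) + 1` over `k`
    ∃! P : Submodule k E,
      Module.finrank k P = (m - 2) + 1 ∧
      -- for all coordinates, `|P|` lies in `X` and is `|W| ∩ X` with its reduced structure
      (∀ (u : Module.Basis (Fin 2) k U) (e : Module.Basis (Fin (2 * m + 1)) k E),
        QuadricPencil.baseLocusIdeal q e ≤ QuadricPencil.linearIdeal e P ∧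
        (QuadricPencil.linearIdeal e (QuadricPencil.radicalSubspace q u e) ⊔
            QuadricPencil.baseLocusIdeal q e).radical =
          QuadricPencil.linearIdeal e P) ∧
      -- it is preserved by all automorphisms of the pencil
      (∀ (g : E ≃ₗ[k] E) (h : U ≃ₗ[k] U), (∀ a x, q (h a) (g x) = q a x) →
        P.map (g : E →ₗ[k] E) = P) ∧
      -- for `m = 2` it is a `k`-rational point of the quartic del Pezzo surface `X`
      (m = 2 → ∃ p : Projectivization k E, p.submodule = P ∧ ∀ a, q a p.rep = 0) := by
  have hfE : FiniteDimensional k E := FiniteDimensional.of_finrank_pos (by omega)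
  have hfU : FiniteDimensional k U := FiniteDimensional.of_finrank_pos (by omega)
  have hcharK : CharP (AlgebraicClosure k) 2 :=
    charP_of_injective_algebraMap (algebraMap k (AlgebraicClosure k)).injective 2
  let u₀ : Module.Basis (Fin 2) k U := Module.finBasisOfFinrankEq k U hU
  let e₀ : Module.Basis (Fin (2 * m + 1)) k E := Module.finBasisOfFinrankEq k E hE
  have hWeq := fun u e => QuadricPencil.radicalSubspace_eq hm hE hq hreg u u₀ e e₀
  have hiso : ∀ a, ∀ x ∈ QuadricPencil.radicalSubspace q u₀ e₀,
      ∀ y ∈ QuadricPencil.radicalSubspace q u₀ e₀, QuadraticMap.polar (q a) x y = 0 :=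
    fun a x hx y hy => QuadricPencil.polar_radicalSubspace q u₀ e₀ a hx hy
  set P := QuadricPencil.zeroLocus q (QuadricPencil.radicalSubspace q u₀ e₀) hiso with hP
  have hrad : ∀ (u : Module.Basis (Fin 2) k U) (e : Module.Basis (Fin (2 * m + 1)) k E),
      (QuadricPencil.linearIdeal e (QuadricPencil.radicalSubspace q u e) ⊔
        QuadricPencil.baseLocusIdeal q e).radical = QuadricPencil.linearIdeal e P := by
    intro u e
    rw [hWeq u e]
    exact QuadricPencil.radical_linearIdeal_sup_baseLocusIdeal q u e _ hiso
  have hrank : Module.finrank k P = (m - 2) + 1 := by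
    obtain ⟨B, hB, hR⟩ := QuadricPencil.exists_bilinForm_isRegularPair hm hE hq hreg u₀
    have h1 : Module.finrank k P + 2 = _ :=
      QuadricPencil.finrank_zeroLocus q u₀ e₀ (by omega) hB hR
    rw [QuadricPencil.finrank_radicalSubspace hm hE hq hreg] at h1
    omega
  refine ⟨P, ⟨hrank, fun u e => ⟨?_, hrad u e⟩, ?_, ?_⟩, ?_⟩
  · rw [← hrad u e]
    exact le_sup_right.trans Ideal.le_radical
  · intro g h hgh
    -- `g(W)` is the radical subspace for the transported bases, and this does not depend on the
    -- bases.
    have hW : (QuadricPencil.radicalSubspace q u₀ e₀).map (g : E →ₗ[k] E)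
        = QuadricPencil.radicalSubspace q u₀ e₀ := by
      rw [← QuadricPencil.radicalSubspace_map hgh]
      exact hWeq _ _
    refine Submodule.eq_of_le_of_finrank_le ?_ (by rw [LinearEquiv.finrank_map_eq])
    rintro _ ⟨x, hx, rfl⟩
    refine ⟨hW ▸ Submodule.mem_map_of_mem hx.1, fun a => ?_⟩
    have := hgh (h.symm a) x
    rw [LinearEquiv.apply_symm_apply, hx.2] at this
    exact this
  · rintro rfl
    obtain ⟨⟨x, hx⟩, hx0, -⟩ := finrank_eq_one_iff'.1 hrank
    have hx0' : x ≠ 0 := fun h => hx0 (Subtype.ext h)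
    have hsub : (Projectivization.mk k x hx0').submodule = P := by
      rw [Projectivization.submodule_mk]
      refine Submodule.eq_of_le_of_finrank_le ((Submodule.span_singleton_le_iff_mem _ _).2 hx) ?_
      rw [hrank, finrank_span_singleton hx0']
    refine ⟨_, hsub, fun a => ?_⟩
    have hrep : (Projectivization.mk k x hx0').rep ∈ P := by
      rw [← hsub, Projectivization.submodule_eq]
      exact Submodule.mem_span_singleton_self _
    exact hrep.2 a
  -- The reduced intersection in a single coordinate system already determines the subspace.
  · rintro P' ⟨-, h, -⟩
    have heq := (h u₀ e₀).2.symm.trans (hrad u₀ e₀)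
    exact le_antisymm (QuadricPencil.mem_of_linearIdeal_le e₀ heq.ge)
      (QuadricPencil.mem_of_linearIdeal_le e₀ heq.le)
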